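/- All graphs are finite, simple and undirected. A graph is uniquely hamiltonian if it has exactly one hamiltonian cycle (as a subgraph), and its degree set is the set of all its vertex degrees. For a finite set $M$ of natural numbers with $2\notin M$, a graph realizes $M$ if it is $3$-connected, uniquely hamiltonian, and has degree set exactly $M$; $M$ is uhc-realizable if some graph realizes it. A set $M=\{d_0<d_1<\dots<d_k\}$ with $k>0$ and $2\notin M$ is strongly uhc-realizable if for each partition of $\{d_1,\dots,d_k\}$ into two disjoint, possibly empty sets $D_1,D_2$ there are constants $c_1\in\mathbb{N}$ and $c_2\in\mathbb{R}$, $c_2>0$, and an infinite sequence of graphs $G_i=(V_i,E_i)$ realizing $M$, with $|V_1|<|V_2|<\cdots$, such that for every $i$, each $d\in D_1$ is the degree of at most $c_1$ vertices of $G_i$, and each $d'\in D_2$ is the degree of at least $c_2|V_i|$ vertices of $G_i$. Theorem. Let $M=\{3,d_1,\dots,d_k\}$ with $k\ge 0$ and $3<d_1<\dots<d_k$ be a finite set of natural numbers. Then $M$ is uhc-realizable if and only if $M$ contains an even number. If $M$ contains an even number, then $M$ is also strongly uhc-realizable. -/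

import Mathlib

namespace UHC

/-- A finite graph is `k`-connected if it has more than `k` vertices and deleting any set of fewer
than `k` vertices leaves a connected graph. -/
def IsKConnected {V : Type} [Fintype V] (G : SimpleGraph V) (k : ℕ) : Prop :=
  k < Fintype.card V ∧
    ∀ S : Finset V, S.card < k → (G.induce {v : V | v ∉ S}).Connected

open Classical in
/-- `C` is the edge set of a hamiltonian cycle of `G`. Closed walks that differ only in the starting
vertex or in the orientation have the same edge set, so a hamiltonian cycle, regarded as a subgraph,
is the same thing as such a set `C`. -/
def IsHamiltonianCycleEdgeSet {V : Type} (G : SimpleGraph V) (C : Set (Sym2 V)) : Prop :=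
  ∃ (a : V) (p : G.Walk a a), p.IsHamiltonianCycle ∧ {e | e ∈ p.edges} = C

/-- A graph is uniquely hamiltonian if it has exactly one hamiltonian cycle. -/
def IsUniquelyHamiltonian {V : Type} (G : SimpleGraph V) : Prop :=
  ∃! C : Set (Sym2 V), IsHamiltonianCycleEdgeSet G C

open Classical in
/-- The degree set of a finite graph. -/
noncomputable def degreeSet {V : Type} [Fintype V] (G : SimpleGraph V) : Set ℕ :=
  Set.range fun v : V => G.degree v

open Classical in
/-- The number of vertices of degree `d`. -/
noncomputable def numDegree {V : Type} [Fintype V] (G : SimpleGraph V) (d : ℕ) : ℕ :=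
  (Finset.univ.filter fun v : V => G.degree v = d).card

/-- `G` realizes `M`: it is uniquely hamiltonian, its degree set is `M`, and it is `2`-connected if
`2 ∈ M` and `3`-connected otherwise. -/
def Realizes {V : Type} [Fintype V] (G : SimpleGraph V) (M : Finset ℕ) : Prop :=
  IsKConnected G (if 2 ∈ M then 2 else 3) ∧ IsUniquelyHamiltonian G ∧ degreeSet G = (M : Set ℕ)

/-- Some finite graph realizes `M`. (Every finite graph is isomorphic to one whose vertex type lives
in `Type`.) -/
def UhcRealizable (M : Finset ℕ) : Prop :=
  ∃ (V : Type) (_ : Fintype V) (G : SimpleGraph V), Realizes G M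

/-- `M` has at least two elements and, for each partition of the non-minimal elements of `M` into two
(possibly empty) parts `D₁`, `D₂`, there are constants `c₁`, `c₂ > 0` and an infinite sequence of
finite graphs of strictly increasing order realizing `M`, each with at most `c₁` vertices of every
degree in `D₁` and at least a fraction `c₂` of its vertices of every degree in `D₂`. -/
def StronglyUhcRealizable (M : Finset ℕ) : Prop :=
  ∃ hM : M.Nonempty, 1 < M.card ∧
    ∀ D₁ D₂ : Finset ℕ, Disjoint D₁ D₂ → D₁ ∪ D₂ = M.erase (M.min' hM) →
      ∃ (c₁ : ℕ) (c₂ : ℝ), 0 < c₂ ∧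
        ∃ (V : ℕ → Type) (_ : ∀ i, Fintype (V i)) (G : ∀ i, SimpleGraph (V i)),
          StrictMono (fun i => Fintype.card (V i)) ∧
          ∀ i, Realizes (G i) M ∧
            (∀ d ∈ D₁, numDegree (G i) d ≤ c₁) ∧
            (∀ d ∈ D₂, c₂ * (Fintype.card (V i) : ℝ) ≤ (numDegree (G i) d : ℝ))

end UHC

/-!
Necessity of an even degree is Thomason's lollipop argument. Fix an edge `xy` and consider the
hamiltonian paths of `G - x` that start at `y`. A path stopping at `r` can be rotated in `deg r - 1`
ways, or in `deg r - 2` ways if `r` is adjacent to `x`, that is, if the path closes up to a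
hamiltonian cycle through `xy`. Rotations can be undone, so they pair up; hence if all degrees are
odd, an even number of paths close up, and `xy` does not lie on exactly one hamiltonian cycle.

Conversely, replacing a vertex of degree 3 of a 3-connected uniquely hamiltonian graph by a suitable
gadget (a graph minus a vertex) keeps it 3-connected and uniquely hamiltonian. A gadget cut from the
Petersen graph raises the degree of one neighbour of the replaced vertex by 2 and otherwise only
adds vertices of degree 3; gadgets cut from the tetrahedron and from a wheel supply fresh vertices
of degree 3 and 4 on which this can be repeated. Starting from a graph whose degrees are 3 and 4,
with two vertices of degree 4, one can therefore add vertices of any prescribed degrees at a bounded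
cost each, and strong realizability follows by repeating the degrees of `D₂` while leaving those of
`D₁` alone.
-/

namespace UHC

/-! ### Degrees and parity -/

section Degree

variable {V : Type*}

/-- The degree of a vertex as an `ncard`, so that it needs no finiteness instance; it is `0` at a
vertex of infinite degree. -/
noncomputable abbrev deg (G : SimpleGraph V) (v : V) : ℕ := (G.neighborSet v).ncard

lemma degree_eq_deg (G : SimpleGraph V) (v : V) [Fintype (G.neighborSet v)] :
    G.degree v = deg G v := by
  rw [deg, ← SimpleGraph.card_neighborSet_eq_degree, Set.ncard_eq_toFinset_card',
    Set.toFinset_card]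

lemma deg_iso {W : Type*} {G : SimpleGraph V} {H : SimpleGraph W} (φ : G ≃g H) (v : V) :
    deg H (φ v) = deg G v :=
  (Nat.card_congr (φ.mapNeighborSet v)).symm

variable [Finite V]

lemma even_ncard_odd_deg (G : SimpleGraph V) : Even {v | Odd (deg G v)}.ncard := by
  classical
  have := Fintype.ofFinite V
  have handshake := G.even_card_odd_degree_vertices
  rw [← Set.ncard_coe_finset] at handshake
  convert handshake using 2
  ext v
  simp [degree_eq_deg]

lemma even_deg_of_forall_ne (G : SimpleGraph V) (x : V) (h : ∀ v, v ≠ x → Even (deg G v)) :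
    Even (deg G x) := by
  by_contra hx
  have only_x : {v | Odd (deg G v)} = {x} := by
    ext v
    by_cases hv : v = x
    · simpa [hv] using hx
    · simpa [hv] using h v hv
  have := even_ncard_odd_deg G
  rw [only_x, Set.ncard_singleton] at this
  exact absurd this (by decide)

lemma eq_of_le_of_deg_le {C G : SimpleGraph V} (hCG : C ≤ G) (h : ∀ v, deg G v ≤ deg C v) :
    C = G := by
  refine le_antisymm hCG fun u v huv => ?_
  have : C.neighborSet u = G.neighborSet u :=
    Set.eq_of_subset_of_ncard_le (fun _ ha => hCG ha) (h u)
  exact this.ge huv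

end Degree

/-! ### Hamiltonian cycles as spanning subgraphs -/

section HamCycle

/-- A connected graph in which all vertices have degree two. A spanning subgraph of a finite graph
with this property is a hamiltonian cycle. -/
structure IsHamCycle {V : Type*} (C : SimpleGraph V) : Prop where
  connected : C.Connected
  deg_eq_two : ∀ v, deg C v = 2

/-- `C` is the only hamiltonian cycle of `G`. -/
structure IsUniqueHamCycle {V : Type*} (G C : SimpleGraph V) : Prop where
  le : C ≤ G
  isHamCycle : IsHamCycle C
  eq : ∀ C', C' ≤ G → IsHamCycle C' → C' = C

variable {V : Type*} {C : SimpleGraph V}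

lemma IsHamCycle.exists_adj (h : IsHamCycle C) (s : V) : ∃ t, C.Adj s t :=
  Set.nonempty_of_ncard_ne_zero (s := C.neighborSet s) (by
    have := h.deg_eq_two s; rw [deg] at this; omega)

lemma isHamCycle_spanningCoe_toSubgraph [DecidableEq V] {a : V} {p : C.Walk a a}
    (hp : p.IsHamiltonianCycle) : IsHamCycle p.toSubgraph.spanningCoe where
  connected :=
    have spanning : p.toSubgraph.IsSpanning := fun v => p.mem_verts_toSubgraph.2 (hp.mem_support v)
    (p.toSubgraph.spanningCoeEquivCoeOfSpanning spanning).connected_iff.2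
      p.toSubgraph_connected.coe
  deg_eq_two v := hp.isCycle.ncard_neighborSet_toSubgraph_eq_two (hp.mem_support v)

variable [Finite V]

lemma isHamCycle_of_deg_eq_two_of_ne [Nontrivial V] (hC : C.Connected) (x : V)
    (h : ∀ v, v ≠ x → deg C v = 2) (hx : deg C x ≤ 3) : IsHamCycle C := by
  have even_x : Even (deg C x) := even_deg_of_forall_ne C x fun v hv => by simp [h v hv]
  have pos_x : 0 < deg C x := by
    obtain ⟨u, hu⟩ := hC.preconnected.exists_adj_of_nontrivial x
    exact (Set.ncard_pos (Set.toFinite _)).2 ⟨u, hu⟩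
  refine ⟨hC, fun v => ?_⟩
  obtain rfl | hv := eq_or_ne v x
  · obtain ⟨k, hk⟩ := even_x
    omega
  · exact h v hv

lemma IsHamCycle.exists_walk [DecidableEq V] (h : IsHamCycle C) {s t : V} (hst : C.Adj s t) :
    ∃ p : C.Walk s s, p.IsHamiltonianCycle ∧ p.snd = t ∧
      ∀ u v, p.toSubgraph.Adj u v ↔ C.Adj u v := by
  have : C.LocallyFinite := fun _ => Fintype.ofFinite _
  have cycles : C.IsCycles := fun v _ => h.deg_eq_two v
  obtain ⟨p, hp, hv⟩ := cycles.exists_cycle_toSubgraph_verts_eq_connectedComponentSupp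
    (c := C.connectedComponentMk s) (v := s) rfl ⟨t, hst⟩
  have spanning : ∀ v, v ∈ p.toSubgraph.verts := by
    intro v
    rw [hv, SimpleGraph.ConnectedComponent.mem_supp_iff, SimpleGraph.ConnectedComponent.eq]
    exact h.connected.preconnected _ _
  have hadj : ∀ u v, p.toSubgraph.Adj u v ↔ C.Adj u v := fun u v =>
    hp.adj_toSubgraph_iff_of_isCycles cycles (spanning u) v
  obtain ⟨q, hq, hqs, hqv⟩ := hp.exists_isCycle_snd_verts_eq ((hadj s t).2 hst)
  refine ⟨q, ?_, hqs, fun u v => hq.adj_toSubgraph_iff_of_isCycles cycles (hqv ▸ spanning u) v⟩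
  rw [SimpleGraph.Walk.isHamiltonianCycle_iff_isCycle_and_support_count_tail_eq_one]
  refine ⟨hq, fun a => List.count_eq_one_of_mem hq.support_nodup ?_⟩
  have ha : a ∈ q.support := q.mem_verts_toSubgraph.1 (hqv ▸ spanning a)
  rcases List.mem_cons.1 (q.cons_tail_support ▸ ha) with rfl | h
  · exact SimpleGraph.Walk.end_mem_tail_support hq.not_nil
  · exact h

theorem isHamiltonianCycleEdgeSet_iff {V : Type} [Finite V] (G : SimpleGraph V) (S : Set (Sym2 V)) :
    IsHamiltonianCycleEdgeSet G S ↔ ∃ C : SimpleGraph V, C ≤ G ∧ IsHamCycle C ∧ C.edgeSet = S := by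
  classical
  have := Fintype.ofFinite V
  constructor
  · rintro ⟨a, p, hp, rfl⟩
    refine ⟨p.toSubgraph.spanningCoe, p.toSubgraph.spanningCoe_le,
      isHamCycle_spanningCoe_toSubgraph (by convert hp), ?_⟩
    ext e
    rw [SimpleGraph.Subgraph.edgeSet_spanningCoe, SimpleGraph.Walk.mem_edges_toSubgraph]
    rfl
  · rintro ⟨C, hCG, hC, rfl⟩
    obtain ⟨s⟩ := hC.connected.nonempty
    obtain ⟨t, ht⟩ := hC.exists_adj s
    obtain ⟨p, hp, -, hadj⟩ := hC.exists_walk ht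
    refine ⟨s, p.mapLe hCG, ?_, ?_⟩
    · convert hp.map (f := SimpleGraph.Hom.ofLE hCG) Function.bijective_id
    · ext e
      simp only [SimpleGraph.Walk.edges_mapLe_eq_edges, Set.mem_ofPred_eq]
      rw [← SimpleGraph.Walk.mem_edges_toSubgraph]
      induction e with
      | _ u v => exact hadj u v

theorem isUniquelyHamiltonian_iff {V : Type} [Finite V] (G : SimpleGraph V) :
    IsUniquelyHamiltonian G ↔ ∃ C, IsUniqueHamCycle G C := by
  simp only [IsUniquelyHamiltonian, ExistsUnique, isHamiltonianCycleEdgeSet_iff]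
  constructor
  · rintro ⟨_, ⟨C, hle, hC, rfl⟩, hu⟩
    exact ⟨C, hle, hC, fun C' h1 h2 => SimpleGraph.edgeSet_inj.1 (hu _ ⟨C', h1, h2, rfl⟩)⟩
  · rintro ⟨C, hle, hC, hu⟩
    refine ⟨C.edgeSet, ⟨C, hle, hC, rfl⟩, ?_⟩
    rintro _ ⟨C', h1, h2, rfl⟩
    rw [hu C' h1 h2]

end HamCycle

/-! ### Hamiltonian paths off a vertex -/

section HamPathOff

/-- The list `l` runs along a hamiltonian path of `G - x` that starts at `y`. The path is stored
backwards, so that the head of `l` is the vertex where it stops. -/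
structure IsHamPathOff {V : Type*} (G : SimpleGraph V) (x y : V) (l : List V) : Prop where
  isChain : l.IsChain G.Adj
  nodup : l.Nodup
  mem_iff : ∀ v, v ∈ l ↔ v ≠ x
  getLast?_eq : l.getLast? = some y

variable {V : Type*} {G C : SimpleGraph V} {x y r : V} {l l' : List V}

lemma IsHamPathOff.mono (h : IsHamPathOff C x y l) (hCG : C ≤ G) : IsHamPathOff G x y l :=
  ⟨h.isChain.imp fun _ _ huv => hCG huv, h.nodup, h.mem_iff, h.getLast?_eq⟩

lemma IsHamCycle.exists_isHamPathOff [Finite V] (h : IsHamCycle C) (hxy : C.Adj x y) :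
    ∃ r l, IsHamPathOff C x y (r :: l) ∧ C.Adj x r := by
  classical
  have := Fintype.ofFinite V
  obtain ⟨p, hp, rfl, -⟩ := h.exists_walk hxy
  obtain ⟨r, hxr, q, hq⟩ := p.tail.reverse.exists_eq_cons_of_ne hxy.ne
  have tail_ham := hp.isHamiltonian_tail
  have tail_path := tail_ham.isPath.reverse
  rw [hq, SimpleGraph.Walk.cons_isPath_iff] at tail_path
  have support_eq : q.support = r :: q.support.tail := q.cons_tail_support.symm
  refine ⟨r, q.support.tail, ?_, hxr⟩
  rw [← support_eq]
  refine ⟨q.isChain_adj_support, tail_path.1.support_nodup, fun v => ⟨?_, fun hv => ?_⟩, ?_⟩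
  · rintro hv rfl
    exact tail_path.2 hv
  · have : v ∈ p.tail.reverse.support :=
      p.tail.support_reverse ▸ List.mem_reverse.2 (tail_ham.mem_support v)
    rw [hq, SimpleGraph.Walk.support_cons] at this
    exact (List.mem_cons.1 this).resolve_left hv
  · rw [List.getLast?_eq_some_getLast (by simp), SimpleGraph.Walk.getLast_support]

lemma isHamiltonianCycle_cons_concat [DecidableEq V] {q : G.Walk r y} (hq : q.IsPath)
    (mem_iff : ∀ v, v ∈ q.support ↔ v ≠ x) (hyx : G.Adj y x) (hxr : G.Adj x r) (hry : r ≠ y) :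
    (SimpleGraph.Walk.cons hxr (q.concat hyx)).IsHamiltonianCycle := by
  have x_notMem : x ∉ q.support := fun hx => (mem_iff x).1 hx rfl
  have cycle : (SimpleGraph.Walk.cons hxr (q.concat hyx)).IsCycle := by
    refine (SimpleGraph.Walk.cons_isCycle_iff _ hxr).2
      ⟨(SimpleGraph.Walk.concat_isPath_iff _).2 ⟨hq, x_notMem⟩, fun he => ?_⟩
    simp only [SimpleGraph.Walk.edges_concat, List.concat_eq_append, List.mem_append,
      List.mem_singleton, Sym2.eq_iff] at he
    rcases he with he | ⟨hx, -⟩ | ⟨-, hr⟩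
    · exact x_notMem (q.fst_mem_support_of_mem_edges he)
    · exact hyx.ne' hx
    · exact hry hr
  rw [SimpleGraph.Walk.isHamiltonianCycle_iff_isCycle_and_support_count_tail_eq_one]
  refine ⟨cycle, fun v => List.count_eq_one_of_mem cycle.support_nodup ?_⟩
  obtain rfl | hv := eq_or_ne v x
  · simp
  · simp [SimpleGraph.Walk.support_concat, (mem_iff v).2 hv]

lemma IsHamPathOff.exists_isHamCycle (h : IsHamPathOff G x y (r :: l)) (hry : r ≠ y)
    (hxy : G.Adj x y) (hxr : G.Adj x r) :
    ∃ D ≤ G, IsHamCycle D ∧ D.Adj x y ∧ IsHamPathOff D x y (r :: l) := by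
  classical
  obtain ⟨q, support_q⟩ : ∃ q : G.Walk r y, q.support = r :: l := by
    have last_eq : (r :: l).getLast (by simp) = y :=
      Option.some.inj ((List.getLast?_eq_some_getLast _).symm.trans h.getLast?_eq)
    exact ⟨(SimpleGraph.Walk.ofSupport (r :: l) (by simp) h.isChain).copy rfl last_eq,
      (SimpleGraph.Walk.support_copy _ _ _).trans (SimpleGraph.Walk.support_ofSupport _ _)⟩
  have ham := isHamiltonianCycle_cons_concat (.mk' (support_q ▸ h.nodup))
    (fun v => support_q ▸ h.mem_iff v) hxy.symm hxr hry
  set p := SimpleGraph.Walk.cons hxr (q.concat hxy.symm) with hp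
  have edges_p : p.edges = s(x, r) :: (q.edges ++ [s(y, x)]) := by
    rw [hp, SimpleGraph.Walk.edges_cons, SimpleGraph.Walk.edges_concat, List.concat_eq_append]
  have adj_iff : ∀ u v, p.toSubgraph.spanningCoe.Adj u v ↔ s(u, v) ∈ p.edges := fun _ _ =>
    p.adj_toSubgraph_iff_mem_edges
  have edges_q : ∀ e ∈ q.edges, e ∈ p.toSubgraph.spanningCoe.edgeSet := by
    rintro ⟨u, v⟩ he
    exact (adj_iff u v).2 (edges_p ▸ List.mem_cons_of_mem _ (List.mem_append_left _ he))
  refine ⟨p.toSubgraph.spanningCoe, p.toSubgraph.spanningCoe_le,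
    isHamCycle_spanningCoe_toSubgraph ham, ?_, ?_, h.nodup, h.mem_iff, h.getLast?_eq⟩
  · exact (adj_iff x y).2 (by simp [edges_p, Sym2.eq_swap])
  · rw [← support_q, ← q.support_transfer edges_q]
    exact (q.transfer _ edges_q).isChain_adj_support

lemma eq_of_isChain_of_deg_eq_two (hC : ∀ v, deg C v = 2) :
    ∀ {k k' : List V} {x y : V}, (x :: y :: k).IsChain C.Adj → (x :: y :: k').IsChain C.Adj →
      (x :: y :: k).Nodup → (x :: y :: k').Nodup → k.length = k'.length → k = k'
  | [], [], _, _, _, _, _, _, _ => rfl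
  | a :: k, b :: k', x, y, hk, hk', nodup_k, nodup_k', hlen => by
    simp only [List.isChain_cons_cons, List.nodup_cons, List.mem_cons, not_or] at *
    have a_eq_b : a = b := by
      by_contra hab
      have : ({x, a, b} : Set V).ncard ≤ deg C y := Set.ncard_le_ncard (by
        rintro v (rfl | rfl | rfl)
        exacts [hk.1.symm, hk.2.1, hk'.2.1])
        (Set.finite_of_ncard_ne_zero (by have := hC y; unfold deg at this; omega))
      rw [hC y, Set.ncard_eq_three.2 ⟨x, a, b, by tauto, by tauto, hab, rfl⟩] at this
      omega
    subst a_eq_b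
    rw [eq_of_isChain_of_deg_eq_two hC (k := k) (k' := k') (x := y) (y := a)]
    all_goals simp_all [List.isChain_cons_cons]

lemma IsHamCycle.isHamPathOff_unique (hC : IsHamCycle C) (hxy : C.Adj x y)
    (h : IsHamPathOff C x y l) (h' : IsHamPathOff C x y l') : l = l' := by
  have reverse_eq : ∀ {l}, IsHamPathOff C x y l → ∃ k, l.reverse = y :: k ∧
      (x :: y :: k).IsChain C.Adj ∧ (x :: y :: k).Nodup := by
    intro l h
    obtain ⟨m, rfl⟩ := List.getLast?_eq_some_iff.1 h.getLast?_eq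
    refine ⟨m.reverse, by simp, ?_, ?_⟩
    · have := List.isChain_reverse.2 (h.isChain.imp fun _ _ => C.adj_symm)
      exact List.isChain_cons_cons.2 ⟨hxy, by simpa using this⟩
    · have x_notMem : x ∉ (m ++ [y]).reverse := fun hx =>
        (h.mem_iff x).1 (List.mem_reverse.1 hx) rfl
      simpa using List.nodup_cons.2 ⟨x_notMem, List.nodup_reverse.2 h.nodup⟩
  obtain ⟨k, hk, chain_k, nodup_k⟩ := reverse_eq h
  obtain ⟨k', hk', chain_k', nodup_k'⟩ := reverse_eq h'
  have perm : l.Perm l' := (List.perm_ext_iff_of_nodup h.nodup h'.nodup).2 fun v =>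
    (h.mem_iff v).trans (h'.mem_iff v).symm
  have length_eq : k.length = k'.length := by
    have := perm.length_eq
    rw [← l.length_reverse, ← l'.length_reverse, hk, hk'] at this
    simpa using this
  rw [← List.reverse_inj, hk, hk',
    eq_of_isChain_of_deg_eq_two hC.deg_eq_two chain_k chain_k' nodup_k nodup_k' length_eq]

end HamPathOff

/-! ### Thomason's lollipop argument -/

section Lollipop

variable {V : Type*} {G : SimpleGraph V} {x y v r w : V} {l m k : List V}

/-- The vertices at which a path `l` can be rotated: the neighbours of its head that occur in `l`
after its second vertex. -/
def rotationPoints (G : SimpleGraph V) (l : List V) : Set V :=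
  {v | ∃ r m w k, l = r :: (m ++ w :: v :: k) ∧ G.Adj r v}

lemma IsHamPathOff.rotate (h : IsHamPathOff G x y (r :: (m ++ w :: v :: k))) (hrv : G.Adj r v) :
    IsHamPathOff G x y (w :: (m.reverse ++ r :: v :: k)) := by
  have perm : (w :: (m.reverse ++ r :: v :: k)).Perm (r :: (m ++ w :: v :: k)) := by
    simpa using (r :: m ++ [w]).reverse_perm.append_right (v :: k)
  refine ⟨?_, perm.nodup_iff.2 h.nodup, fun u => perm.mem_iff.trans (h.mem_iff u), ?_⟩
  · have chain := h.isChain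
    rw [← List.cons_append, List.isChain_append_cons_cons] at chain
    rw [← List.cons_append, List.isChain_append_cons_cons]
    refine ⟨?_, hrv, chain.2.2⟩
    simpa using List.isChain_reverse.2 (chain.1.imp fun _ _ => G.adj_symm)
  · have := h.getLast?_eq
    simp_all [List.getLast?_cons, List.getLast?_append]

section Involution

variable [DecidableEq V]

/-- Joining the head of a path `l` to a rotation point `v` closes a cycle with a tail (a lollipop).
Deleting the other edge of the cycle that precedes `v` leaves the path `rotate l v`. -/
def rotate (l : List V) (v : V) : List V :=
  (l.takeWhile (· ≠ v)).reverse ++ l.dropWhile (· ≠ v)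

lemma rotate_eq (h : (r :: (m ++ w :: v :: k)).Nodup) :
    rotate (r :: (m ++ w :: v :: k)) v = w :: (m.reverse ++ r :: v :: k) := by
  have split : r :: (m ++ w :: v :: k) = (r :: m ++ [w]) ++ v :: k := by simp
  have before_ne : ∀ a ∈ r :: m ++ [w], decide (a ≠ v) = true := by
    rw [split] at h
    simpa using fun a ha => (List.nodup_append.1 h).2.2 a ha v (by simp)
  rw [rotate, split, List.takeWhile_append_of_pos before_ne, List.dropWhile_append_of_pos before_ne]
  simp

lemma IsHamPathOff.rotate_of_mem (h : IsHamPathOff G x y l) (hv : v ∈ rotationPoints G l) :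
    IsHamPathOff G x y (UHC.rotate l v) ∧ v ∈ rotationPoints G (UHC.rotate l v) ∧
      UHC.rotate (UHC.rotate l v) v = l ∧ UHC.rotate l v ≠ l := by
  obtain ⟨r, m, w, k, rfl, hrv⟩ := hv
  have rotated := h.rotate hrv
  have hwv : G.Adj w v :=
    (List.isChain_append_cons_cons.1 (List.cons_append ▸ h.isChain)).2.1
  rw [rotate_eq h.nodup, rotate_eq rotated.nodup, m.reverse_reverse]
  refine ⟨rotated, ⟨w, m.reverse, r, k, rfl, hwv⟩, rfl, fun heq => ?_⟩
  have := h.nodup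
  simp_all

end Involution

lemma IsHamPathOff.exists_cons_cons (h : IsHamPathOff G x y l) {z : V} (hzx : z ≠ x)
    (hzy : z ≠ y) : ∃ r w m, l = r :: w :: m ∧ r ≠ y := by
  have hz := (h.mem_iff z).2 hzx
  have last_eq := h.getLast?_eq
  have nodup := h.nodup
  rcases l with _ | ⟨r, _ | ⟨w, m⟩⟩
  · simp at hz
  · simp_all
  · refine ⟨r, w, m, rfl, ?_⟩
    rintro rfl
    rw [List.getLast?_cons_cons] at last_eq
    exact (List.nodup_cons.1 nodup).1 (List.mem_of_getLast? last_eq)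

variable [Finite V]

lemma ncard_rotationPoints (h : IsHamPathOff G x y (r :: w :: l)) :
    (rotationPoints G (r :: w :: l)).ncard + 1 = (G.neighborSet r \ {x}).ncard := by
  have nodup := h.nodup
  have w_notMem : w ∉ rotationPoints G (r :: w :: l) := by
    rintro ⟨_, _ | ⟨_, m⟩, w', k, heq, -⟩ <;> simp_all
  rw [← Set.ncard_insert_of_notMem w_notMem]
  congr 1
  ext v
  simp only [Set.mem_insert_iff, Set.mem_sdiff, SimpleGraph.mem_neighborSet, Set.mem_singleton_iff]
  constructor
  · rintro (rfl | ⟨r', m, w', k, heq, hadj⟩)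
    · exact ⟨(List.isChain_cons_cons.1 h.isChain).1, (h.mem_iff v).1 (by simp)⟩
    · obtain rfl := (List.cons.inj heq).1
      exact ⟨hadj, (h.mem_iff v).1 (by simp [heq])⟩
  · rintro ⟨hadj, hvx⟩
    refine or_iff_not_imp_left.2 fun hvw => ?_
    have mem_l : v ∈ l := by simpa [hadj.ne', hvw] using (h.mem_iff v).2 hvx
    obtain ⟨s, t, rfl⟩ := List.append_of_mem mem_l
    obtain ⟨m, u, hmu⟩ := (List.eq_nil_or_concat (w :: s)).resolve_left (by simp)
    exact ⟨r, m, u, t, by rw [← List.cons_append, hmu]; simp, hadj⟩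

lemma odd_ncard_rotationPoints_iff (h : IsHamPathOff G x y (r :: w :: l)) (hr : Odd (deg G r)) :
    Odd (rotationPoints G (r :: w :: l)).ncard ↔ G.Adj x r := by
  have ncard_eq := ncard_rotationPoints h
  rw [deg] at hr
  by_cases hxr : G.Adj x r
  · have := Set.ncard_sdiff_singleton_add_one (s := G.neighborSet r) hxr.symm
    grind
  · rw [Set.sdiff_singleton_eq_self (fun h => hxr h.symm)] at ncard_eq
    grind

open Classical in
lemma even_sum_ncard_rotationPoints {P : Finset (List V)} (hP : ∀ l, l ∈ P ↔ IsHamPathOff G x y l) :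
    Even (∑ l ∈ P, (rotationPoints G l).ncard) := by
  have := Fintype.ofFinite V
  have card_eq : ∀ l, (rotationPoints G l).ncard = (rotationPoints G l).toFinset.card := fun l =>
    Set.ncard_eq_toFinset_card' _
  simp only [card_eq]
  rw [← Finset.card_sigma, ← ZMod.natCast_eq_zero_iff_even, Finset.cast_card]
  refine Finset.sum_involution (fun p _ => ⟨UHC.rotate p.1 p.2, p.2⟩) (fun _ _ => rfl) ?_ ?_ ?_
  all_goals
    rintro ⟨l, v⟩ hp
    simp only [Finset.mem_sigma, hP, Set.mem_toFinset] at hp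
    obtain ⟨ham, mem, rotate_rotate, rotate_ne⟩ := hp.1.rotate_of_mem hp.2
  · exact fun _ heq => rotate_ne (congrArg Sigma.fst heq)
  · simpa [hP] using ⟨ham, mem⟩
  · simp [rotate_rotate]

end Lollipop

theorem IsUniqueHamCycle.exists_even_deg {V : Type*} [Finite V] {G C : SimpleGraph V}
    (h : IsUniqueHamCycle G C) : ∃ v, Even (deg G v) := by
  classical
  have := Fintype.ofFinite V
  by_contra! hodd
  simp only [Nat.not_even_iff_odd] at hodd
  obtain ⟨x⟩ := h.isHamCycle.connected.nonempty
  obtain ⟨y, hxy⟩ := h.isHamCycle.exists_adj x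
  obtain ⟨r, l, path_l, hxr⟩ := h.isHamCycle.exists_isHamPathOff hxy
  obtain ⟨z, hxz, hzy⟩ : ∃ z ∈ C.neighborSet x, z ≠ y :=
    Set.exists_ne_of_one_lt_ncard (one_lt_two.trans_eq (h.isHamCycle.deg_eq_two x).symm) y
  have finite_paths : {l | IsHamPathOff G x y l}.Finite :=
    (Set.finite_coe_iff.1 (inferInstanceAs (Finite {l : List V // l.Nodup}))).subset
      fun _ hl => hl.nodup
  let P := finite_paths.toFinset
  have hP : ∀ l, l ∈ P ↔ IsHamPathOff G x y l := by simp [P]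
  have even_card := (Finset.even_sum_iff_even_card_odd _).1 (even_sum_ncard_rotationPoints hP)
  suffices only_path : {l ∈ P | Odd (rotationPoints G l).ncard} = {r :: l} by
    simp [only_path] at even_card
  have odd_iff : ∀ s t, IsHamPathOff G x y (s :: t) →
      (Odd (rotationPoints G (s :: t)).ncard ↔ G.Adj x s) := by
    intro s t hst
    obtain ⟨_, w, t, heq, -⟩ := hst.exists_cons_cons hxz.ne' hzy
    obtain ⟨rfl, rfl⟩ := List.cons.inj heq
    exact odd_ncard_rotationPoints_iff hst (hodd _)
  refine Finset.eq_singleton_iff_unique_mem.2 ⟨?_, fun p hp => ?_⟩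
  · have path_G := path_l.mono h.le
    exact Finset.mem_filter.2 ⟨(hP _).2 path_G, (odd_iff r l path_G).2 (h.le hxr)⟩
  · obtain ⟨hp, odd_p⟩ := Finset.mem_filter.1 hp
    obtain ⟨s, w, t, rfl, hsy⟩ := ((hP p).1 hp).exists_cons_cons hxz.ne' hzy
    have closed : G.Adj x s := (odd_iff _ _ ((hP _).1 hp)).1 odd_p
    obtain ⟨D, hDG, ham_D, -, path_D⟩ := ((hP _).1 hp).exists_isHamCycle hsy (h.le hxy) closed
    rw [h.eq D hDG ham_D] at path_D
    exact h.isHamCycle.isHamPathOff_unique hxy path_D path_l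

/-! ### Connectivity -/

section Connectivity

variable {V W : Type*} {G : SimpleGraph V}

/-- The graph `G` with all edges at vertices of `S` removed. The vertices of `S` stay as isolated
vertices, so that the vertex type does not change. -/
def isolate (G : SimpleGraph V) (S : Set V) : SimpleGraph V where
  Adj u v := G.Adj u v ∧ u ∉ S ∧ v ∉ S
  symm.symm _ _ h := ⟨h.1.symm, h.2.2, h.2.1⟩
  loopless.irrefl _ h := G.irrefl h.1

/-- Any two vertices outside `S` are joined by a path avoiding `S`. -/
def ConnectedOff (G : SimpleGraph V) (S : Set V) : Prop :=
  ∀ u v, u ∉ S → v ∉ S → (isolate G S).Reachable u v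

/-- Deleting any two vertices, possibly equal, leaves a connected graph. For graphs with more than
three vertices this is `3`-connectivity, see `isKConnected_three_iff`. -/
def ThreeConnected (G : SimpleGraph V) : Prop := ∀ x y, ConnectedOff G {x, y}

lemma connectedOff_of_forall_reachable {S : Set V} (r : V)
    (h : ∀ u, u ∉ S → (isolate G S).Reachable u r) : ConnectedOff G S :=
  fun u v hu hv => (h u hu).trans (h v hv).symm

lemma ThreeConnected.connectedOff_singleton (h : ThreeConnected G) (x : V) :
    ConnectedOff G {x} := by
  simpa using h x x

lemma ThreeConnected.connectedOff_empty [Fintype V] (h : ThreeConnected G)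
    (hV : 2 < Fintype.card V) : ConnectedOff G ∅ := by
  classical
  intro u v _ _
  obtain ⟨z, hz⟩ := Finset.exists_mem_notMem_of_card_lt_card
    (s := {u, v}) (t := Finset.univ) ((Finset.card_le_two).trans_lt hV)
  have hz : z ≠ u ∧ z ≠ v := by simpa using hz
  exact (h.connectedOff_singleton z u v hz.1.symm hz.2.symm).mono
    fun a b (hab : (isolate G {z}).Adj a b) => ⟨hab.1, id, id⟩

lemma connectedOff_iff_preconnected_induce (G : SimpleGraph V) (S : Set V) :
    ConnectedOff G S ↔ (G.induce {v | v ∉ S}).Preconnected := by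
  constructor
  · rintro h ⟨u, hu⟩ ⟨v, hv⟩
    obtain ⟨p⟩ := h u v hu hv
    induction p with
    | nil => rfl
    | cons hab _ ih =>
      have : (G.induce {v | v ∉ S}).Adj ⟨_, hu⟩ ⟨_, hab.2.2⟩ := hab.1
      exact this.reachable.trans (ih hab.2.2 hv)
  · intro h u v hu hv
    exact (h ⟨u, hu⟩ ⟨v, hv⟩).map (⟨fun x => x.1, fun {a b} hab => ⟨hab, a.2, b.2⟩⟩ :
      G.induce {v | v ∉ S} →g isolate G S)

theorem isKConnected_three_iff {V : Type} [Fintype V] (G : SimpleGraph V) :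
    IsKConnected G 3 ↔ 3 < Fintype.card V ∧ ThreeConnected G := by
  classical
  refine and_congr_right fun hV => ⟨fun h x y => ?_, fun h S hS => ?_⟩
  · rw [← Finset.coe_pair, connectedOff_iff_preconnected_induce]
    exact (h {x, y} (Finset.card_le_two.trans_lt (by norm_num))).preconnected
  · obtain ⟨x, -, hx⟩ := Finset.exists_mem_notMem_of_card_lt_card (hS.trans hV)
    have off : ConnectedOff G S := by
      interval_cases hc : S.card
      · obtain rfl := Finset.card_eq_zero.1 hc
        simpa using h.connectedOff_empty (by omega)
      · obtain ⟨a, rfl⟩ := Finset.card_eq_one.1 hc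
        simpa using h.connectedOff_singleton a
      · obtain ⟨a, b, -, rfl⟩ := Finset.card_eq_two.1 hc
        simpa using h a b
    have : Nonempty {v : V | v ∉ S} := ⟨⟨x, hx⟩⟩
    exact ⟨(connectedOff_iff_preconnected_induce G S).1 off⟩

lemma ConnectedOff.of_iso {H : SimpleGraph W} {S : Set W} (φ : G ≃g H)
    (h : ConnectedOff G (φ ⁻¹' S)) : ConnectedOff H S := by
  intro u v hu hv
  obtain ⟨u, rfl⟩ := φ.surjective u
  obtain ⟨v, rfl⟩ := φ.surjective v
  exact (h u v hu hv).map (⟨φ, fun {_ _} hab => ⟨φ.map_adj_iff.2 hab.1, hab.2⟩⟩ :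
    isolate G (φ ⁻¹' S) →g isolate H S)

section Option

variable {A : Type*} {G : SimpleGraph (Option A)}

lemma reachable_comap_some_or {a : A} {v : Option A} (h : G.Reachable (some a) v) :
    (∃ a', some a' = v ∧ (G.comap some).Reachable a a') ∨
      ∃ a', G.Adj none (some a') ∧ (G.comap some).Reachable a a' := by
  obtain ⟨p⟩ := h
  generalize hu : some a = u at p
  induction p generalizing a with
  | nil => exact .inl ⟨a, hu, .rfl⟩
  | @cons u w v huw p ih =>
    subst hu
    rcases w with _ | b
    · exact .inr ⟨a, huw.symm, .rfl⟩
    · have hab : (G.comap some).Reachable a b := SimpleGraph.Adj.reachable huw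
      exact (ih rfl).imp (fun ⟨a', h1, h2⟩ => ⟨a', h1, hab.trans h2⟩)
        (fun ⟨a', h1, h2⟩ => ⟨a', h1, hab.trans h2⟩)

lemma exists_adj_none_of_reachable {a : A} (h : G.Reachable (some a) none) :
    ∃ a', G.Adj none (some a') ∧ (G.comap some).Reachable a a' := by
  simpa using reachable_comap_some_or h

lemma reachable_comap_some_isolate {S : Set (Option A)} {a a' : A} (hS : none ∈ S)
    (h : (isolate G S).Reachable (some a) (some a')) :
    ((isolate G S).comap some).Reachable a a' := by
  obtain ⟨b, hb, hab⟩ | ⟨b, hb, -⟩ := reachable_comap_some_or h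
  · rwa [← Option.some.inj hb]
  · exact absurd hS hb.2.1

end Option

end Connectivity

section Glue

variable {A B : Type*}

/-- The graph obtained from the disjoint union of `G` and `H` by deleting the two vertices `none`
and joining `a` to `b` whenever `X a b`. -/
def glue (G : SimpleGraph (Option A)) (H : SimpleGraph (Option B)) (X : A → B → Prop) :
    SimpleGraph (A ⊕ B) where
  Adj
    | .inl a, .inl a' => G.Adj (some a) (some a')
    | .inr b, .inr b' => H.Adj (some b) (some b')
    | .inl a, .inr b => X a b
    | .inr b, .inl a => X a b
  symm.symm x y h := by
    rcases x with a | a <;> rcases y with b | b <;> first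
      | exact h
      | exact SimpleGraph.Adj.symm (G := G) h
      | exact SimpleGraph.Adj.symm (G := H) h
  loopless.irrefl x h := by
    rcases x with a | a
    · exact G.irrefl h
    · exact H.irrefl h

variable {G : SimpleGraph (Option A)} {H : SimpleGraph (Option B)} {X : A → B → Prop}

@[simp] lemma glue_inl_inl (a a' : A) :
    (glue G H X).Adj (.inl a) (.inl a') ↔ G.Adj (some a) (some a') := Iff.rfl

@[simp] lemma glue_inl_inr (a : A) (b : B) : (glue G H X).Adj (.inl a) (.inr b) ↔ X a b := Iff.rfl

@[simp] lemma glue_inr_inl (a : A) (b : B) : (glue G H X).Adj (.inr b) (.inl a) ↔ X a b := Iff.rfl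

/-- Gluing is symmetric in the two sides. -/
def glueComm (G : SimpleGraph (Option A)) (H : SimpleGraph (Option B)) (X : A → B → Prop) :
    glue G H X ≃g glue H G (fun b a => X a b) where
  toEquiv := Equiv.sumComm A B
  map_rel_iff' := by rintro (_ | _) (_ | _) <;> rfl

lemma deg_glue_inl {a : A} {b : B} (h : ∀ b', X a b' ↔ b' = b ∧ G.Adj (some a) none) :
    deg (glue G H X) (.inl a) = deg G (some a) := by
  let φ : Option A → A ⊕ B := fun o => o.elim (.inr b) .inl
  have hφ : Function.Injective φ := by
    rintro (_ | x) (_ | y) hxy <;> simp_all [φ]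
  rw [deg, deg, ← Set.ncard_image_of_injective _ hφ]
  congr 1
  ext (x | x)
  · simp [φ, Option.exists]
  · simp [φ, Option.exists, h, eq_comm, and_comm]

lemma deg_glue_inr {a : A} {b : B} (h : ∀ a', X a' b ↔ a' = a ∧ H.Adj (some b) none) :
    deg (glue G H X) (.inr b) = deg H (some b) :=
  (deg_iso (glueComm G H X) (.inr b)).symm.trans (deg_glue_inl h)

lemma reachable_glue_inl {S : Set (A ⊕ B)} {T : Set (Option A)} (hT : ∀ x, .inl x ∈ S → some x ∈ T)
    {a a' : A} (h : ((isolate G T).comap some).Reachable a a') :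
    (isolate (glue G H X) S).Reachable (.inl a) (.inl a') :=
  h.map (⟨Sum.inl, fun {_ _} hab => ⟨hab.1, fun h => hab.2.1 (hT _ h), fun h => hab.2.2 (hT _ h)⟩⟩ :
    (isolate G T).comap some →g isolate (glue G H X) S)

lemma reachable_glue_inr {S : Set (A ⊕ B)} {T : Set (Option B)} (hT : ∀ x, .inr x ∈ S → some x ∈ T)
    {b b' : B} (h : ((isolate H T).comap some).Reachable b b') :
    (isolate (glue G H X) S).Reachable (.inr b) (.inr b') :=
  h.map (⟨Sum.inr, fun {_ _} hab => ⟨hab.1, fun h => hab.2.1 (hT _ h), fun h => hab.2.2 (hT _ h)⟩⟩ :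
    (isolate H T).comap some →g isolate (glue G H X) S)

lemma ThreeConnected.reachable_comap_some (hG : ThreeConnected G) {x : Option A} {a a' : A}
    (ha : some a ≠ x) (ha' : some a' ≠ x) :
    ((isolate G {none, x}).comap some).Reachable a a' :=
  reachable_comap_some_isolate (by simp) (hG none x (some a) (some a') (by simpa) (by simpa))

lemma connectedOff_glue_inl_inl (hG : ThreeConnected G) (hH : ThreeConnected H)
    (hX : ∀ a, G.Adj none (some a) → ∃ b, X a b) [Nonempty B] (x y : A) :
    ConnectedOff (glue G H X) {.inl x, .inl y} := by
  have right_side : ∀ b b' : B,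
      (isolate (glue G H X) {.inl x, .inl y}).Reachable (.inr b) (.inr b') := fun b b' =>
    reachable_glue_inr (by simp) (hH.reachable_comap_some (x := none) (by simp) (by simp))
  refine connectedOff_of_forall_reachable (.inr (Classical.arbitrary B)) ?_
  rintro (a | b) hu
  · obtain ⟨a', h1, h2⟩ := exists_adj_none_of_reachable
      (hG (some x) (some y) (some a) none (by simpa using hu) (by simp))
    obtain ⟨b, hb⟩ := hX a' h1.1
    have cross : (isolate (glue G H X) {.inl x, .inl y}).Adj (.inl a') (.inr b) :=
      ⟨hb, by simpa using h1.2.2, by simp⟩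
    exact (reachable_glue_inl (by simp) h2).trans (cross.reachable.trans (right_side b _))
  · exact right_side b _

lemma connectedOff_glue_inl_inr (hG : ThreeConnected G) (hH : ThreeConnected H) {x : A} {y : B}
    {a : A} {b : B} (ha : a ≠ x) (hb : b ≠ y) (hab : X a b) :
    ConnectedOff (glue G H X) {.inl x, .inr y} := by
  have cross : (isolate (glue G H X) {.inl x, .inr y}).Adj (.inl a) (.inr b) :=
    ⟨hab, by simpa using ha, by simpa using hb⟩
  refine connectedOff_of_forall_reachable (.inr b) ?_
  rintro (a' | b') hu
  · exact (reachable_glue_inl (by simp) (hG.reachable_comap_some (x := some x)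
      (by simpa using hu) (by simpa using ha))).trans cross.reachable
  · exact reachable_glue_inr (by simp) (hH.reachable_comap_some (x := some y)
      (by simpa using hu) (by simpa using hb))

theorem threeConnected_glue [Nonempty A] [Nonempty B] (hG : ThreeConnected G)
    (hH : ThreeConnected H) (hX : ∀ a, G.Adj none (some a) → ∃ b, X a b)
    (hX' : ∀ b, H.Adj none (some b) → ∃ a, X a b)
    (hX₂ : ∀ x y, ∃ a b, a ≠ x ∧ b ≠ y ∧ X a b) : ThreeConnected (glue G H X) := by
  rintro (x | x) (y | y)
  · exact connectedOff_glue_inl_inl hG hH hX x y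
  · obtain ⟨a, b, ha, hb, hab⟩ := hX₂ x y
    exact connectedOff_glue_inl_inr hG hH ha hb hab
  · obtain ⟨a, b, ha, hb, hab⟩ := hX₂ y x
    rw [Set.pair_comm]
    exact connectedOff_glue_inl_inr hG hH ha hb hab
  · refine .of_iso (glueComm H G fun b a => X a b) ?_
    convert connectedOff_glue_inl_inl (X := fun b a => X a b) hH hG hX' x y using 1
    ext (z | z) <;> simp [glueComm]

end Glue

/-! ### Contractions of hamiltonian cycles -/

section Contraction

variable {V W : Type*} {C : SimpleGraph V}

lemma connected_map (hC : C.Connected) {f : V → W} (hf : f.Surjective) : (C.map f).Connected := by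
  have := hC.nonempty.map f
  refine ⟨fun x y => ?_⟩
  obtain ⟨u, rfl⟩ := hf x
  obtain ⟨v, rfl⟩ := hf y
  obtain ⟨p⟩ := hC.preconnected u v
  induction p with
  | nil => rfl
  | @cons a b c hab _ ih =>
    by_cases h : f a = f b
    · rw [h]; exact ih
    · exact (SimpleGraph.map_adj_apply' hab h).reachable.trans ih

lemma deg_map {f : V → W} {u : V} (hu : ∀ v, f v = f u → v = u)
    (hinj : Set.InjOn f (C.neighborSet u)) : deg (C.map f) (f u) = deg C u := by
  rw [deg, deg, ← hinj.ncard_image]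
  congr 1
  ext x
  simp only [SimpleGraph.mem_neighborSet, Set.mem_image, SimpleGraph.map_adj']
  constructor
  · rintro ⟨-, u', v', h, h1, h2⟩
    rw [hu u' h1] at h
    exact ⟨v', h, h2⟩
  · rintro ⟨v, hv, rfl⟩
    exact ⟨fun h => hv.ne (hu v h.symm).symm, u, v, hv, rfl, rfl⟩

/-- Contracting a fibre that every vertex outside meets in at most one edge preserves all degrees
outside. By parity the new vertex has degree two as soon as its degree is at most three. -/
lemma IsHamCycle.map {B : Type*} [Finite B] [Nonempty B] (hC : IsHamCycle C) {f : V → Option B}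
    (hf : f.Surjective) (hinj : ∀ u v, f u = f v → f u = none ∨ u = v)
    (hone : ∀ u v v', f u ≠ none → C.Adj u v → C.Adj u v' → f v = none → f v' = none → v = v')
    (hnone : deg (C.map f) none ≤ 3) : IsHamCycle (C.map f) := by
  refine isHamCycle_of_deg_eq_two_of_ne (connected_map hC.connected hf) none ?_ hnone
  intro x hx
  obtain ⟨u, rfl⟩ := hf x
  rw [deg_map, hC.deg_eq_two]
  · exact fun v hv => (hinj v u hv).resolve_left (hv ▸ hx)
  · intro v hv v' hv' hvv'
    exact (hinj v v' hvv').elim (fun h => hone u v v' hx hv hv' h (hvv' ▸ h)) id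

lemma IsHamCycle.preconnected_comap_some {A : Type*} [Finite A] {C : SimpleGraph (Option A)}
    (hC : IsHamCycle C) : (C.comap some).Preconnected := by
  classical
  obtain ⟨t, ht⟩ := hC.exists_adj none
  obtain ⟨p, hp, rfl, -⟩ := hC.exists_walk ht
  obtain ⟨r, hr⟩ := Option.ne_none_iff_exists'.1 ht.ne'
  suffices h : ∀ a, (C.comap some).Reachable r a from fun a b => (h a).symm.trans (h b)
  intro a
  have ha : some a ∈ p.tail.support := hp.isHamiltonian_tail.mem_support _
  let q := p.tail.takeUntil (some a) ha
  have none_notMem : none ∉ q.support :=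
    SimpleGraph.Walk.endpoint_notMem_support_takeUntil hp.isHamiltonian_tail.isPath ha (by simp)
  have edges_off : ∀ e ∈ q.edges, e ∈ (isolate C {none}).edgeSet := by
    rintro ⟨u, v⟩ he
    have hu := q.fst_mem_support_of_mem_edges he
    have hv := q.snd_mem_support_of_mem_edges he
    exact ⟨q.adj_of_mem_edges he, ne_of_mem_of_not_mem hu none_notMem,
      ne_of_mem_of_not_mem hv none_notMem⟩
  have off_none : (isolate C {none}).Reachable (some r) (some a) :=
    hr ▸ (q.transfer _ edges_off).reachable
  exact (reachable_comap_some_isolate (Set.mem_singleton none) off_none).mono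
    fun x y (h : (isolate C {none}).Adj (some x) (some y)) => h.1

end Contraction

/-! ### Splicing two graphs along a port -/

/-- A way in which the edges at the vertex `none` of a graph on `Option B` are to be used when that
vertex is removed: the edges to `fst` and `snd` are for hamiltonian cycles, those to the vertices of
`rest` are to be avoided. -/
structure Port (B : Type*) where
  fst : B
  snd : B
  rest : Set B

namespace Port

variable {A B : Type*}

/-- The neighbours of `none` in `H` are `fst`, `snd` and the vertices of `rest`, without
repetition. -/
structure IsAt (q : Port B) (H : SimpleGraph (Option B)) : Prop where
  fst_ne_snd : q.fst ≠ q.snd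
  fst_notMem : q.fst ∉ q.rest
  snd_notMem : q.snd ∉ q.rest
  adj_none : ∀ b, H.Adj none (some b) ↔ b = q.fst ∨ b = q.snd ∨ b ∈ q.rest

/-- The port that remains once no edge to `rest` is left. -/
def core (q : Port B) : Port B := ⟨q.fst, q.snd, ∅⟩

/-- The edges joining the two sides when the ports `p` and `q` are connected. -/
def Cross (p : Port A) (q : Port B) (a : A) (b : B) : Prop :=
  (a = p.fst ∧ b = q.fst) ∨ (a = p.snd ∧ b = q.snd) ∨ (a ∈ p.rest ∧ b ∈ q.rest)

/-- `none` avoids the vertices of `rest`. -/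
def IsAvoided (q : Port B) (D : SimpleGraph (Option B)) : Prop :=
  ∀ b ∈ q.rest, ¬D.Adj none (some b)

/-- `D` is the only hamiltonian cycle of `H` that passes through `none` by way of `fst` and
`snd`. -/
structure IsUniquePassage (q : Port B) (H D : SimpleGraph (Option B)) : Prop where
  le : D ≤ H
  isHamCycle : IsHamCycle D
  isAvoided : q.IsAvoided D
  eq : ∀ D' ≤ H, IsHamCycle D' → q.IsAvoided D' → D' = D

/-- `H` with its vertex `none` split into a vertex `none` adjacent to `fst` and `snd` and a vertex
`some none` adjacent to the vertices of `rest`. -/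
def split (q : Port B) (H : SimpleGraph (Option B)) : SimpleGraph (Option (Option B)) where
  Adj
    | some (some b), some (some b') => H.Adj (some b) (some b')
    | none, some (some b) => b = q.fst ∨ b = q.snd
    | some (some b), none => b = q.fst ∨ b = q.snd
    | some none, some (some b) => b ∈ q.rest
    | some (some b), some none => b ∈ q.rest
    | _, _ => False
  symm.symm x y h := by
    rcases x with _ | _ | x <;> rcases y with _ | _ | y <;> first
      | exact h
      | exact SimpleGraph.Adj.symm (G := H) h
  loopless.irrefl x h := by
    rcases x with _ | _ | x
    · exact h
    · exact h
    · exact H.irrefl h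

variable {p : Port A} {q : Port B} {G C₁ : SimpleGraph (Option A)} {H C₂ : SimpleGraph (Option B)}

lemma cross_comm {a : A} {b : B} : p.Cross q a b ↔ q.Cross p b a := by
  simp only [Cross, and_comm]

lemma not_isHamCycle_of_le_split {b : B} (hq : q.rest = {b}) :
    ∀ D ≤ q.split H, ¬IsHamCycle D := by
  intro D hD h
  have single : D.neighborSet (some none) ⊆ {some (some b)} := by
    rintro (_ | _ | b') hb
    · exact (hD hb).elim
    · exact (hD hb).elim
    · have : b' ∈ q.rest := hD hb
      rw [hq] at this
      simpa using this
  have := Set.ncard_le_ncard single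
  rw [Set.ncard_singleton] at this
  have := h.deg_eq_two (some none)
  rw [deg] at this
  omega

namespace IsAt

lemma cross_left_unique (hq : q.IsAt H) (hp : p.rest.Subsingleton) {a a' : A} {b : B}
    (h : p.Cross q a b) (h' : p.Cross q a' b) : a = a' := by
  have := hq.fst_ne_snd
  have := hq.fst_notMem
  have := hq.snd_notMem
  rcases h with ⟨rfl, rfl⟩ | ⟨rfl, rfl⟩ | ⟨h1, h2⟩ <;>
    rcases h' with ⟨rfl, h4⟩ | ⟨rfl, h4⟩ | ⟨h3, h4⟩
  all_goals first | rfl | exact hp h1 h3 | grind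

lemma cross_right_unique (hp : p.IsAt G) {a : A} (ha : a ∉ p.rest) {b b' : B}
    (h : p.Cross q a b) (h' : p.Cross q a b') : b = b' := by
  have := hp.fst_ne_snd
  grind [Cross]

lemma adj_none_of_cross (hp : p.IsAt G) {a : A} {b : B} (h : p.Cross q a b) :
    G.Adj none (some a) :=
  (hp.adj_none a).2 (h.imp And.left (Or.imp And.left And.left))

lemma deg_splice_inl (hp : p.IsAt G) {a : A} (ha : a ∉ p.rest) :
    deg (glue G H (p.Cross q)) (.inl a) = deg G (some a) := by
  classical
  have := hp.fst_ne_snd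
  refine deg_glue_inl (b := if a = p.fst then q.fst else q.snd) fun b' => ?_
  rw [G.adj_comm, hp.adj_none, Cross]
  split_ifs <;> grind

lemma deg_splice_inr (hq : q.IsAt H) {w : A} (hp : p.rest = {w}) (b : B) :
    deg (glue G H (p.Cross q)) (.inr b) = deg H (some b) := by
  classical
  have := hq.fst_ne_snd
  have := hq.fst_notMem
  have := hq.snd_notMem
  refine deg_glue_inr (a := if b = q.fst then p.fst else if b = q.snd then p.snd else w)
    fun a' => ?_
  rw [H.adj_comm, hq.adj_none, Cross, hp]
  split_ifs <;> grind

lemma core [Finite B] (hq : q.IsAt H) (hle : C₂ ≤ H) (hC : IsHamCycle C₂) (h : q.IsAvoided C₂) :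
    q.core.IsAt C₂ where
  fst_ne_snd := hq.fst_ne_snd
  fst_notMem := id
  snd_notMem := id
  adj_none := by
    have sub : C₂.neighborSet none ⊆ {some q.fst, some q.snd} := by
      rintro (_ | b) hb
      · exact absurd hb C₂.irrefl
      · rcases (hq.adj_none b).1 (hle hb) with rfl | rfl | hr
        · simp
        · simp
        · exact absurd hb (h b hr)
    have nbrs := Set.eq_of_subset_of_ncard_le sub (by
      rw [Set.ncard_pair (by simpa using hq.fst_ne_snd)]
      exact (hC.deg_eq_two none).ge)
    intro b
    rw [← SimpleGraph.mem_neighborSet, nbrs]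
    simp [Port.core]

lemma isAvoided_of_adj_of_adj (hq : q.IsAt H) (hC : IsHamCycle C₂)
    (h₁ : C₂.Adj none (some q.fst)) (h₂ : C₂.Adj none (some q.snd)) : q.IsAvoided C₂ := by
  intro b hb h
  obtain ⟨x, y, -, hN⟩ := Set.ncard_eq_two.1 (hC.deg_eq_two none)
  have nbrs : ∀ b, C₂.Adj none b → b = x ∨ b = y := fun b hb => by
    rw [← SimpleGraph.mem_neighborSet, hN] at hb
    exact hb
  have := hq.fst_ne_snd
  have := hq.fst_notMem
  have := hq.snd_notMem
  grind

lemma isHamCycle_splice [Finite A] [Finite B] (hp : p.IsAt C₁) (hq : q.IsAt C₂)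
    (hp₀ : p.rest = ∅) (hq₀ : q.rest = ∅) (hC₁ : IsHamCycle C₁) (hC₂ : IsHamCycle C₂) :
    IsHamCycle (glue C₁ C₂ (p.Cross q)) := by
  constructor
  · have left_side : ∀ a, (glue C₁ C₂ (p.Cross q)).Reachable (.inl a) (.inl p.fst) :=
      fun a => (hC₁.preconnected_comap_some a p.fst).map
        (⟨Sum.inl, fun {_ _} h => h⟩ : C₁.comap some →g _)
    have right_side : ∀ b, (glue C₁ C₂ (p.Cross q)).Reachable (.inr b) (.inr q.fst) :=
      fun b => (hC₂.preconnected_comap_some b q.fst).map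
        (⟨Sum.inr, fun {_ _} h => h⟩ : C₂.comap some →g _)
    have bridge : (glue C₁ C₂ (p.Cross q)).Adj (.inr q.fst) (.inl p.fst) := .inl ⟨rfl, rfl⟩
    have to_fst : ∀ x, (glue C₁ C₂ (p.Cross q)).Reachable x (.inl p.fst) := by
      rintro (a | b)
      · exact left_side a
      · exact (right_side b).trans bridge.reachable
    exact SimpleGraph.connected_iff_exists_forall_reachable _ |>.2 ⟨_, fun x => (to_fst x).symm⟩
  · rintro (a | b)
    · rw [hp.deg_splice_inl (by simp [hp₀]), hC₁.deg_eq_two]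
    · rw [← deg_iso (glueComm _ _ _)]
      simp only [cross_comm (p := p)]
      exact (hq.deg_splice_inl (by simp [hq₀])).trans (hC₂.deg_eq_two _)

end IsAt

end Port

section Splice

variable {A B : Type*} {p : Port A} {q : Port B} {G C₁ : SimpleGraph (Option A)}
  {H C₂ : SimpleGraph (Option B)} {C : SimpleGraph (A ⊕ B)} {w : A}

theorem threeConnected_splice (hG : ThreeConnected G) (hH : ThreeConnected H) (hp : p.IsAt G)
    (hq : q.IsAt H) (hp₀ : p.rest.Nonempty) (hq₀ : q.rest.Nonempty) :
    ThreeConnected (glue G H (p.Cross q)) := by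
  have : Nonempty A := ⟨p.fst⟩
  have : Nonempty B := ⟨q.fst⟩
  obtain ⟨w, hw⟩ := hp₀
  obtain ⟨β, hβ⟩ := hq₀
  have cross₀ : p.Cross q p.fst q.fst := .inl ⟨rfl, rfl⟩
  have cross₁ : p.Cross q p.snd q.snd := .inr (.inl ⟨rfl, rfl⟩)
  have cross₂ : ∀ a ∈ p.rest, ∀ b ∈ q.rest, p.Cross q a b := fun _ ha _ hb => .inr (.inr ⟨ha, hb⟩)
  refine threeConnected_glue hG hH (fun a ha => ?_) (fun b hb => ?_) fun x y => ?_
  · rcases (hp.adj_none a).1 ha with rfl | rfl | ha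
    exacts [⟨_, cross₀⟩, ⟨_, cross₁⟩, ⟨_, cross₂ a ha β hβ⟩]
  · rcases (hq.adj_none b).1 hb with rfl | rfl | hb
    exacts [⟨_, cross₀⟩, ⟨_, cross₁⟩, ⟨_, cross₂ w hw b hb⟩]
  · obtain ⟨ne₁, fst₁, snd₁, -⟩ := hp
    obtain ⟨ne₂, fst₂, snd₂, -⟩ := hq
    by_cases h₀ : p.fst ≠ x ∧ q.fst ≠ y
    · exact ⟨_, _, h₀.1, h₀.2, cross₀⟩
    by_cases h₁ : p.snd ≠ x ∧ q.snd ≠ y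
    · exact ⟨_, _, h₁.1, h₁.2, cross₁⟩
    exact ⟨w, β, by grind, by grind, cross₂ w hw β hβ⟩

lemma map_getLeft_some_some {a a' : A} :
    (C.map Sum.getLeft?).Adj (some a) (some a') ↔ C.Adj (.inl a) (.inl a') := by
  simpa [SimpleGraph.map_adj'] using fun h : C.Adj (.inl a) (.inl a') => by simpa using h.ne

lemma map_getRight_some_some {b b' : B} :
    (C.map Sum.getRight?).Adj (some b) (some b') ↔ C.Adj (.inr b) (.inr b') := by
  simpa [SimpleGraph.map_adj'] using fun h : C.Adj (.inr b) (.inr b') => by simpa using h.ne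

lemma map_getLeft_none_some {a : A} :
    (C.map Sum.getLeft?).Adj none (some a) ↔ ∃ b, C.Adj (.inl a) (.inr b) := by
  simp [SimpleGraph.map_adj', C.adj_comm]

lemma map_getRight_none_some {b : B} :
    (C.map Sum.getRight?).Adj none (some b) ↔ ∃ a, C.Adj (.inl a) (.inr b) := by
  simp [SimpleGraph.map_adj', C.adj_comm]

lemma map_getLeft_le (hp : p.IsAt G) (hC : C ≤ glue G H (p.Cross q)) :
    C.map Sum.getLeft? ≤ G := by
  rintro (_ | a) (_ | a') h
  · exact absurd rfl h.ne
  · obtain ⟨b, hb⟩ := map_getLeft_none_some.1 h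
    exact hp.adj_none_of_cross (hC hb)
  · obtain ⟨b, hb⟩ := map_getLeft_none_some.1 h.symm
    exact (hp.adj_none_of_cross (hC hb)).symm
  · exact hC (map_getLeft_some_some.1 h)

lemma map_getRight_le (hq : q.IsAt H) (hC : C ≤ glue G H (p.Cross q)) :
    C.map Sum.getRight? ≤ H := by
  rintro (_ | b) (_ | b') h
  · exact absurd rfl h.ne
  · obtain ⟨a, ha⟩ := map_getRight_none_some.1 h
    exact hq.adj_none_of_cross (Port.cross_comm.1 (hC ha))
  · obtain ⟨a, ha⟩ := map_getRight_none_some.1 h.symm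
    exact (hq.adj_none_of_cross (Port.cross_comm.1 (hC ha))).symm
  · exact hC (map_getRight_some_some.1 h)

section Split

variable [DecidableEq A]

/-- The contraction of `glue G H (p.Cross q)` onto `q.split H` that keeps the vertex `.inl w` apart
from the other vertices on the left. -/
def splitMap (w : A) : A ⊕ B → Option (Option B)
  | .inl a => if a = w then some none else none
  | .inr b => some (some b)

lemma map_splitMap_le (hw : p.rest = {w}) (hp : p.IsAt G) (hC : C ≤ glue G H (p.Cross q))
    (hleft : ∀ a, ¬C.Adj (.inl w) (.inl a)) : C.map (splitMap w) ≤ q.split H := by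
  rintro x y ⟨hne, u, v, huv, rfl, rfl⟩
  have hglue := hC huv
  have := hp.fst_notMem
  have := hp.snd_notMem
  rcases u with a | b <;> rcases v with a' | b' <;> simp only [splitMap] at hne ⊢
  case inr.inr => exact hglue
  all_goals split_ifs <;> grind [Port.Cross, Port.split, glue, SimpleGraph.adj_comm]

lemma isHamCycle_map_splitMap [Finite B] (hw : p.rest = {w}) (hp : p.IsAt G) (hq : q.IsAt H)
    (hC : C ≤ glue G H (p.Cross q)) (hham : IsHamCycle C)
    (hleft : ∀ a, ¬C.Adj (.inl w) (.inl a)) : IsHamCycle (C.map (splitMap w)) := by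
  have fst_ne : p.fst ≠ w := by simpa [hw] using hp.fst_notMem
  refine hham.map ?_ ?_ ?_ ?_
  · rintro (_ | _ | b)
    exacts [⟨.inl p.fst, by simp [splitMap, fst_ne]⟩, ⟨.inl w, by simp [splitMap]⟩, ⟨.inr b, rfl⟩]
  · rintro (a | b) (a' | b') <;> simp only [splitMap] <;> grind
  · rintro (a | b) (a' | b') (a'' | b'') hu h h' hv hv' <;> simp only [splitMap] at * <;> try grind
    exact congrArg _ (hq.cross_left_unique (by simp [hw]) (hC h.symm) (hC h'.symm))
  · have sub : (C.map (splitMap w)).neighborSet none ⊆ {some (some q.fst), some (some q.snd)} := by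
      rintro (_ | _ | b) hb
      · exact (map_splitMap_le hw hp hC hleft hb).elim
      · exact (map_splitMap_le hw hp hC hleft hb).elim
      · have hb : b = q.fst ∨ b = q.snd := map_splitMap_le hw hp hC hleft hb
        simpa using hb
    exact (Set.ncard_le_ncard sub).trans ((Set.ncard_insert_le _ _).trans (by simp))

end Split

/-- If `C` entered the right side from `w` twice, then its part on the right would be a hamiltonian
cycle once the ends of the other two crossing edges are joined to one new vertex and those of the
two edges at `w` to another one. -/
lemma eq_of_adj_hub [Finite A] [Finite B] (hw : p.rest = {w}) (hp : p.IsAt G) (hq : q.IsAt H)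
    (hsplit : ∀ D ≤ q.split H, ¬IsHamCycle D) (hC : C ≤ glue G H (p.Cross q))
    (hham : IsHamCycle C) {b b' : B} (h : C.Adj (.inl w) (.inr b)) (h' : C.Adj (.inl w) (.inr b')) :
    b = b' := by
  classical
  by_contra hne
  have nbrs : {.inr b, .inr b'} = C.neighborSet (.inl w) := Set.eq_of_subset_of_ncard_le
    (Set.pair_subset h h') (by
      rw [Set.ncard_pair (by simpa using hne)]
      exact (hham.deg_eq_two _).le)
  have hleft : ∀ a, ¬C.Adj (.inl w) (.inl a) := fun a ha => by
    rw [← SimpleGraph.mem_neighborSet, ← nbrs] at ha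
    simp at ha
  exact hsplit _ (map_splitMap_le hw hp hC hleft) (isHamCycle_map_splitMap hw hp hq hC hham hleft)

lemma isHamCycle_map_getLeft [Finite A] [Finite B] (hw : p.rest = {w}) (hp : p.IsAt G)
    (hq : q.IsAt H) (hsplit : ∀ D ≤ q.split H, ¬IsHamCycle D) (hC : C ≤ glue G H (p.Cross q))
    (hham : IsHamCycle C) : IsHamCycle (C.map Sum.getLeft?) := by
  have : Nonempty A := ⟨w⟩
  refine hham.map ?_ ?_ ?_ ?_
  · rintro (_ | a)
    exacts [⟨.inr q.fst, rfl⟩, ⟨.inl a, rfl⟩]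
  · rintro (a | b) (a' | b') <;> simp
  · rintro (a | b) (a' | b') (a'' | b'') hu h h' hv hv' <;> try simp at hu hv hv'
    refine congrArg _ ?_
    by_cases ha : a = w
    · subst ha
      exact eq_of_adj_hub hw hp hq hsplit hC hham h h'
    · exact hp.cross_right_unique (by simpa [hw] using ha) (hC h) (hC h')
  · have sub : (C.map Sum.getLeft?).neighborSet none ⊆ {some p.fst, some p.snd, some w} := by
      rintro (_ | a) ha
      · exact absurd ha (SimpleGraph.notMem_neighborSet_self _)
      · simpa [hw] using (hp.adj_none a).1 (map_getLeft_le hp hC ha)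
    calc _ ≤ _ := Set.ncard_le_ncard sub
      _ ≤ _ := Set.ncard_insert_le _ _
      _ ≤ 3 := Nat.succ_le_succ ((Set.ncard_insert_le _ _).trans (by simp))

lemma isHamCycle_map_getRight [Finite A] [Finite B] (hw : p.rest = {w}) (hp : p.IsAt G)
    (hq : q.IsAt H) (hsplit : ∀ D ≤ q.split H, ¬IsHamCycle D) (hC : C ≤ glue G H (p.Cross q))
    (hham : IsHamCycle C) : IsHamCycle (C.map Sum.getRight?) := by
  have : Nonempty B := ⟨q.fst⟩
  refine hham.map ?_ ?_ ?_ ?_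
  · rintro (_ | b)
    exacts [⟨.inl w, rfl⟩, ⟨.inr b, rfl⟩]
  · rintro (a | b) (a' | b') <;> simp
  · rintro (a | b) (a' | b') (a'' | b'') hu h h' hv hv' <;> try simp at hu hv hv'
    exact congrArg _ (hq.cross_left_unique (by simp [hw]) (hC h.symm) (hC h'.symm))
  · have hub_le : {b | C.Adj (.inl w) (.inr b)}.ncard ≤ 1 := (Set.ncard_le_one_iff).2
      fun h h' => eq_of_adj_hub hw hp hq hsplit hC hham h h'
    have sub : (C.map Sum.getRight?).neighborSet none ⊆
        some '' insert q.fst (insert q.snd {b | C.Adj (.inl w) (.inr b)}) := by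
      rintro (_ | b) hb
      · exact absurd hb (SimpleGraph.notMem_neighborSet_self _)
      · obtain ⟨a, ha⟩ := map_getRight_none_some.1 hb
        have cross := hC ha
        refine Set.mem_image_of_mem _ ?_
        simp only [glue_inl_inr, Port.Cross, hw, Set.mem_singleton_iff] at cross
        grind
    calc _ ≤ _ := Set.ncard_le_ncard sub
      _ ≤ _ := Set.ncard_image_le
      _ ≤ _ := Set.ncard_insert_le _ _
      _ ≤ 3 := Nat.succ_le_succ ((Set.ncard_insert_le _ _).trans (Nat.succ_le_succ hub_le))

lemma map_getLeft_adj_fst_iff (hw : p.rest = {w}) (hp : p.IsAt G) (hq : q.IsAt H)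
    (hC : C ≤ glue G H (p.Cross q)) :
    (C.map Sum.getLeft?).Adj none (some p.fst) ↔ (C.map Sum.getRight?).Adj none (some q.fst) := by
  rw [map_getLeft_none_some, map_getRight_none_some]
  have cross : p.Cross q p.fst q.fst := .inl ⟨rfl, rfl⟩
  constructor
  · rintro ⟨b, hb⟩
    exact ⟨p.fst, hp.cross_right_unique hp.fst_notMem (hC hb) cross ▸ hb⟩
  · rintro ⟨a, ha⟩
    exact ⟨q.fst, hq.cross_left_unique (by simp [hw]) (hC ha) cross ▸ ha⟩

lemma map_getLeft_adj_snd_iff (hw : p.rest = {w}) (hp : p.IsAt G) (hq : q.IsAt H)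
    (hC : C ≤ glue G H (p.Cross q)) :
    (C.map Sum.getLeft?).Adj none (some p.snd) ↔ (C.map Sum.getRight?).Adj none (some q.snd) := by
  rw [map_getLeft_none_some, map_getRight_none_some]
  have cross : p.Cross q p.snd q.snd := .inr (.inl ⟨rfl, rfl⟩)
  constructor
  · rintro ⟨b, hb⟩
    exact ⟨p.snd, hp.cross_right_unique hp.snd_notMem (hC hb) cross ▸ hb⟩
  · rintro ⟨a, ha⟩
    exact ⟨q.snd, hq.cross_left_unique (by simp [hw]) (hC ha) cross ▸ ha⟩

/-- A hamiltonian cycle of the splice that crosses it once at `fst` and once at `snd` is made up of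
the unique passages of the two sides. The hypothesis `hpair` excludes all others. -/
theorem isUniqueHamCycle_splice [Finite A] [Finite B] (hw : p.rest = {w}) (hp : p.IsAt G)
    (hq : q.IsAt H) (hsplit : ∀ D ≤ q.split H, ¬IsHamCycle D) (h₁ : p.IsUniquePassage G C₁)
    (h₂ : q.IsUniquePassage H C₂)
    (hpair : ∀ D₁ ≤ G, ∀ D₂ ≤ H, IsHamCycle D₁ → IsHamCycle D₂ →
      (D₁.Adj none (some p.fst) ∨ D₂.Adj none (some q.fst)) ∧
        (D₁.Adj none (some p.snd) ∨ D₂.Adj none (some q.snd))) :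
    IsUniqueHamCycle (glue G H (p.Cross q)) (glue C₁ C₂ (p.core.Cross q.core)) := by
  have core₁ := hp.core h₁.le h₁.isHamCycle h₁.isAvoided
  have core₂ := hq.core h₂.le h₂.isHamCycle h₂.isAvoided
  have ham := core₁.isHamCycle_splice core₂ rfl rfl h₁.isHamCycle h₂.isHamCycle
  refine ⟨?_, ham, fun C hC hham => ?_⟩
  · rintro (a | b) (a' | b') h
    exacts [h₁.le h, h.imp_right (.imp_right fun h => h.1.elim),
      h.imp_right (.imp_right fun h => h.1.elim), h₂.le h]
  have le₁ := map_getLeft_le hp hC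
  have le₂ := map_getRight_le hq hC
  have ham₁ := isHamCycle_map_getLeft hw hp hq hsplit hC hham
  have ham₂ := isHamCycle_map_getRight hw hp hq hsplit hC hham
  have fst_iff := map_getLeft_adj_fst_iff hw hp hq hC
  have snd_iff := map_getLeft_adj_snd_iff hw hp hq hC
  obtain ⟨use_fst, use_snd⟩ := hpair _ le₁ _ le₂ ham₁ ham₂
  have avoided₁ := hp.isAvoided_of_adj_of_adj ham₁ (use_fst.elim id fst_iff.2)
    (use_snd.elim id snd_iff.2)
  have avoided₂ := hq.isAvoided_of_adj_of_adj ham₂ (use_fst.elim fst_iff.1 id)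
    (use_snd.elim snd_iff.1 id)
  have eq₁ := h₁.eq _ le₁ ham₁ avoided₁
  have eq₂ := h₂.eq _ le₂ ham₂ avoided₂
  refine eq_of_le_of_deg_le ?_ fun v => by rw [ham.deg_eq_two, hham.deg_eq_two]
  have cross : ∀ {a b}, C.Adj (.inl a) (.inr b) → p.core.Cross q.core a b := fun {a b} h =>
    (hC h).imp_right (.imp_right fun hr =>
      absurd (map_getLeft_none_some.2 ⟨b, h⟩) (avoided₁ a hr.1))
  rintro (a | b) (a' | b') h
  exacts [eq₁ ▸ map_getLeft_some_some.2 h, cross h, cross h.symm, eq₂ ▸ map_getRight_some_some.2 h]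

end Splice

/-! ### Gadgets -/

section Gadget

variable {A B : Type*} {p : Port A} {q : Port B} {G C : SimpleGraph (Option A)}
  {H D : SimpleGraph (Option B)} {w : A}

/-- A graph that may replace a vertex of degree three of a uniquely hamiltonian graph: by
`IsGadget.isUniqueHamCycle_splice`, the result is uniquely hamiltonian again. -/
structure IsGadget (q : Port B) (H D : SimpleGraph (Option B)) : Prop where
  threeConnected : ThreeConnected H
  isAt : q.IsAt H
  rest_nonempty : q.rest.Nonempty
  not_isHamCycle_of_le_split : ∀ D' ≤ q.split H, ¬IsHamCycle D'
  isUniquePassage : q.IsUniquePassage H D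

lemma IsHamCycle.exists_port [Finite A] (hC : IsHamCycle C) (hle : C ≤ G) {v : Option A}
    (hd : deg G none = 3) (hv : G.Adj none v) (hCv : ¬C.Adj none v) :
    ∃ (p : Port A) (w : A), v = some w ∧ p.rest = {w} ∧ p.IsAt G ∧ p.IsAvoided C := by
  obtain ⟨x, y, hxy, nbrsC⟩ := Set.ncard_eq_two.1 (hC.deg_eq_two none)
  have adjC : ∀ u, C.Adj none u ↔ u = x ∨ u = y := fun u => by
    rw [← SimpleGraph.mem_neighborSet, nbrsC]
    rfl
  have ne_none : ∀ u, G.Adj none u → ∃ a, some a = u := fun u hu => by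
    rcases u with _ | a
    exacts [absurd hu G.irrefl, ⟨a, rfl⟩]
  obtain ⟨a, rfl⟩ := ne_none x (hle ((adjC x).2 (.inl rfl)))
  obtain ⟨b, rfl⟩ := ne_none y (hle ((adjC y).2 (.inr rfl)))
  obtain ⟨w, rfl⟩ := ne_none v hv
  have notMem : some w ∉ ({some a, some b} : Set (Option A)) := nbrsC ▸ hCv
  have nbrsG : insert (some w) {some a, some b} = G.neighborSet none :=
    Set.eq_of_subset_of_ncard_le
      (Set.insert_subset hv fun u hu => hle (nbrsC.symm ▸ hu : u ∈ C.neighborSet none)) (by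
        rw [Set.ncard_insert_of_notMem notMem, Set.ncard_pair hxy]
        exact hd.le)
  have hwa : w ≠ a ∧ w ≠ b := by simpa using notMem
  refine ⟨⟨a, b, {w}⟩, w, rfl, rfl, ⟨by simpa using hxy, hwa.1.symm, hwa.2.symm, fun u => ?_⟩, ?_⟩
  · rw [← SimpleGraph.mem_neighborSet, ← nbrsG]
    simp only [Set.mem_insert_iff, Option.some.injEq, Set.mem_singleton_iff]
    tauto
  · rintro _ rfl
    exact hCv

theorem IsGadget.isUniqueHamCycle_splice [Finite A] [Finite B] (hg : IsGadget q H D)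
    (hC : IsUniqueHamCycle G C) (hw : p.rest = {w}) (hp : p.IsAt G) (hpC : p.IsAvoided C) :
    IsUniqueHamCycle (glue G H (p.Cross q)) (glue C D (p.core.Cross q.core)) := by
  have core := hp.core hC.le hC.isHamCycle hpC
  refine UHC.isUniqueHamCycle_splice hw hp hg.isAt hg.not_isHamCycle_of_le_split
    ⟨hC.le, hC.isHamCycle, hpC, fun C' hle hham _ => hC.eq C' hle hham⟩ hg.isUniquePassage
    fun D₁ hle _ _ hham _ => ?_
  rw [hC.eq D₁ hle hham]
  exact ⟨.inl ((core.adj_none _).2 (.inl rfl)), .inl ((core.adj_none _).2 (.inr (.inl rfl)))⟩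

lemma IsGadget.threeConnected_splice (hg : IsGadget q H D) (hG : ThreeConnected G)
    (hw : p.rest = {w}) (hp : p.IsAt G) : ThreeConnected (glue G H (p.Cross q)) :=
  UHC.threeConnected_splice hG hg.threeConnected hp hg.isAt (hw ▸ ⟨w, rfl⟩) hg.rest_nonempty

lemma deg_splice_inl_of_rest_eq_singleton (hp : p.IsAt G) {b : B} (hq : q.rest = {b}) (a : A) :
    deg (glue G H (p.Cross q)) (.inl a) = deg G (some a) := by
  rw [← deg_iso (glueComm G H _)]
  simp only [Port.cross_comm (p := p)]
  exact hp.deg_splice_inr hq a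

lemma deg_splice_hub [Finite A] [Finite B] (hw : p.rest = {w}) (hp : p.IsAt G) :
    deg (glue G H (p.Cross q)) (.inl w) + 1 = deg G (some w) + q.rest.ncard := by
  have fst_ne : p.fst ≠ w := by simpa [hw] using hp.fst_notMem
  have snd_ne : p.snd ≠ w := by simpa [hw] using hp.snd_notMem
  have nbrs_splice : (glue G H (p.Cross q)).neighborSet (.inl w) =
      Sum.inl '' {a | G.Adj (some w) (some a)} ∪ Sum.inr '' q.rest := by
    ext (a | b) <;> simp [Port.Cross, hw, fst_ne.symm, snd_ne.symm]
  have nbrs : G.neighborSet (some w) = insert none (some '' {a | G.Adj (some w) (some a)}) := by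
    ext (_ | a)
    · simpa using ((hp.adj_none w).2 (by simp [hw])).symm
    · simp
  rw [deg, deg, nbrs_splice, nbrs, Set.ncard_insert_of_notMem (by simp),
    Set.ncard_image_of_injective _ (Option.some_injective _), Set.ncard_union_eq (by
      rw [Set.disjoint_left]
      simp), Set.ncard_image_of_injective _ Sum.inl_injective,
    Set.ncard_image_of_injective _ Sum.inr_injective]
  omega

end Gadget

/-! ### Exhaustive search -/

section Search

variable {V : Type*}

/-- Every path of `G` that extends the path `u :: l`, stored backwards, by `n` vertices and stops at
`z` satisfies `P`. -/
def ForallExtension (G : SimpleGraph V) (z : V) (P : List V → Prop) : ℕ → V → List V → Prop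
  | 0, u, l => u = z → P (u :: l)
  | n + 1, u, l => ∀ v, v ∉ u :: l → G.Adj u v → ForallExtension G z P n v (u :: l)

instance ForallExtension.decidable [Fintype V] [DecidableEq V] (G : SimpleGraph V)
    [DecidableRel G.Adj] (z : V) (P : List V → Prop) [DecidablePred P] :
    ∀ n u l, Decidable (ForallExtension G z P n u l)
  | 0, u, l => inferInstanceAs (Decidable (u = z → P (u :: l)))
  | n + 1, u, l =>
    have := ForallExtension.decidable G z P n
    inferInstanceAs (Decidable (∀ v, v ∉ u :: l → G.Adj u v → ForallExtension G z P n v (u :: l)))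

/-- A walk of at most `n` edges joins `u` to `v`. -/
def ReachableIn (G : SimpleGraph V) : ℕ → V → V → Prop
  | 0, u, v => u = v
  | n + 1, u, v => u = v ∨ ∃ w, G.Adj u w ∧ ReachableIn G n w v

instance ReachableIn.decidable [Fintype V] [DecidableEq V] (G : SimpleGraph V)
    [DecidableRel G.Adj] : ∀ n u v, Decidable (ReachableIn G n u v)
  | 0, u, v => inferInstanceAs (Decidable (u = v))
  | n + 1, u, v =>
    have := ReachableIn.decidable G n
    inferInstanceAs (Decidable (u = v ∨ ∃ w, G.Adj u w ∧ ReachableIn G n w v))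

instance isolate.decidableAdj (G : SimpleGraph V) (S : Set V) [DecidableRel G.Adj]
    [DecidablePred (· ∈ S)] : DecidableRel (isolate G S).Adj :=
  fun u v => inferInstanceAs (Decidable (G.Adj u v ∧ u ∉ S ∧ v ∉ S))

variable {G D : SimpleGraph V} {P : List V → Prop} {z : V}

lemma ReachableIn.reachable {n : ℕ} {u v : V} (h : ReachableIn G n u v) : G.Reachable u v := by
  induction n generalizing u with
  | zero => exact h ▸ .rfl
  | succ n ih =>
    obtain rfl | ⟨w, huw, hwv⟩ := h
    exacts [.rfl, huw.reachable.trans (ih hwv)]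

lemma threeConnected_of_reachableIn (n : ℕ)
    (h : ∀ x y, ∃ r, ∀ u ∉ ({x, y} : Set V), ReachableIn (isolate G {x, y}) n u r) :
    ThreeConnected G := fun x y =>
  have ⟨r, hr⟩ := h x y
  connectedOff_of_forall_reachable r fun u hu => (hr u hu).reachable

lemma ForallExtension.of_isChain {m k l : List V} {u : V}
    (h : ForallExtension G z P m.length u l) (chain : (m ++ u :: l).IsChain G.Adj)
    (nodup : (m ++ u :: l).Nodup) (hk : m ++ u :: l = z :: k) : P (z :: k) := by
  induction m using List.reverseRecOn generalizing u l with
  | nil =>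
    obtain ⟨rfl, rfl⟩ := List.cons.inj hk
    exact h rfl
  | append_singleton m v ih =>
    rw [List.append_assoc, List.singleton_append] at chain nodup hk
    rw [List.length_append, List.length_singleton] at h
    refine ih (h v ?_ ?_) chain nodup hk
    · exact (List.nodup_cons.1 (List.nodup_append.1 nodup).2.1).1
    · exact (List.isChain_append_cons_cons.1 chain).2.1.symm

lemma IsHamPathOff.length_add_one [Finite V] {x y : V} {l : List V} (h : IsHamPathOff G x y l) :
    l.length + 1 = Nat.card V := by
  classical
  have := Fintype.ofFinite V
  have toFinset_eq : l.toFinset = Finset.univ.erase x := by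
    ext v
    simpa using h.mem_iff v
  rw [← List.toFinset_card_of_nodup h.nodup, toFinset_eq,
    Finset.card_erase_add_one (Finset.mem_univ x), Finset.card_univ, Nat.card_eq_fintype_card]

lemma IsHamPathOff.of_forallExtension [Finite V] {x y : V} {l : List V} {n : ℕ}
    (h : IsHamPathOff G x y (z :: l)) (hxy : G.Adj x y) (hn : Nat.card V = n + 2)
    (hP : ForallExtension G z P n y [x]) : P (z :: (l ++ [x])) := by
  obtain ⟨m, hm⟩ := List.getLast?_eq_some_iff.1 h.getLast?_eq
  have split_eq : m ++ [y, x] = z :: (l ++ [x]) := by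
    rw [← List.cons_append, hm, List.append_assoc]
    rfl
  have length_eq : m.length = n := by
    have := h.length_add_one
    rw [hm, List.length_append, List.length_singleton] at this
    omega
  subst length_eq
  have chain : (m ++ [y]).IsChain G.Adj := hm ▸ h.isChain
  refine hP.of_isChain ?_ ?_ split_eq
  · exact List.isChain_append_cons_cons.2 ⟨chain, hxy.symm, List.isChain_singleton _⟩
  · have x_notMem : x ∉ z :: l := fun hx => (h.mem_iff x).1 hx rfl
    rw [split_eq, ← List.cons_append]
    exact List.nodup_append.2 ⟨h.nodup, List.nodup_singleton x, by
      rintro a ha _ hb rfl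
      exact x_notMem (List.mem_singleton.1 hb ▸ ha)⟩

lemma IsHamCycle.eq_of_isHamPathOff [Finite V] {C : SimpleGraph V} {x y : V} {l : List V}
    (hC : IsHamCycle C) (hD : IsHamCycle D) (h : IsHamPathOff D x y (z :: l)) (hzy : z ≠ y)
    (hDy : D.Adj x y) (hDz : D.Adj x z) (hCy : C.Adj x y) (hCz : C.Adj x z)
    (hchain : (z :: l).IsChain C.Adj) : D = C := by
  have path : IsHamPathOff (C ⊓ D) x y (z :: l) :=
    ⟨List.isChain_iff_getElem.2 fun i hi => ⟨hchain.getElem i hi,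
      h.isChain.getElem i hi⟩, h.nodup, h.mem_iff, h.getLast?_eq⟩
  obtain ⟨E, hE, hamE, -⟩ := path.exists_isHamCycle hzy ⟨hCy, hDy⟩ ⟨hCz, hDz⟩
  have eq_of_le : ∀ {F}, IsHamCycle F → E ≤ F → E = F := fun hF hle =>
    eq_of_le_of_deg_le hle fun v => by rw [hF.deg_eq_two, hamE.deg_eq_two]
  exact (eq_of_le hD (hE.trans inf_le_right)).symm.trans (eq_of_le hC (hE.trans inf_le_left))

end Search

namespace Port

variable {B : Type*} [Finite B] {q : Port B} {H C D : SimpleGraph (Option B)} {n : ℕ}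

namespace IsAt

lemma exists_isHamPathOff (hq : q.IsAt H) (hle : D ≤ H) (hD : IsHamCycle D) (h : q.IsAvoided D) :
    ∃ l, IsHamPathOff D none (some q.fst) (some q.snd :: l) := by
  have core := hq.core hle hD h
  obtain ⟨r, l, path, hr⟩ := hD.exists_isHamPathOff ((core.adj_none _).2 (.inl rfl))
  obtain ⟨r', w, m, hl, hne⟩ := path.exists_cons_cons (z := some q.core.snd) (by simp)
    (by simpa using core.fst_ne_snd.symm)
  obtain ⟨rfl, -⟩ := List.cons.inj hl
  rcases r with _ | r
  · exact absurd hr D.irrefl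
  · obtain rfl : r = q.core.snd :=
      (((core.adj_none r).1 hr).resolve_left (by simpa using hne)).resolve_right id
    exact ⟨l, path⟩

lemma of_forallExtension {P : List (Option B) → Prop} (hq : q.IsAt H) (hle : D ≤ H)
    (hD : IsHamCycle D) (h : q.IsAvoided D) (hn : Nat.card B = n + 1)
    (hP : ForallExtension H (some q.snd) P n (some q.fst) [none]) :
    ∃ l, IsHamPathOff D none (some q.fst) (some q.snd :: l) ∧ P (some q.snd :: (l ++ [none])) := by
  obtain ⟨l, path⟩ := hq.exists_isHamPathOff hle hD h
  exact ⟨l, path, (path.mono hle).of_forallExtension ((hq.adj_none _).2 (.inl rfl))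
    (by rw [Finite.card_option, hn]) hP⟩

lemma not_isAvoided_of_forallExtension (hq : q.IsAt H) (hn : Nat.card B = n + 1)
    (hP : ForallExtension H (some q.snd) (fun _ => False) n (some q.fst) [none]) (hle : D ≤ H)
    (hD : IsHamCycle D) : ¬q.IsAvoided D := fun h =>
  have ⟨_, _, hFalse⟩ := hq.of_forallExtension hle hD h hn hP
  hFalse

lemma isUniquePassage_of_forallExtension (hq : q.IsAt H) (hle : ∀ u v, C.Adj u v → H.Adj u v)
    (hC : IsHamCycle C) (h : ∀ b ∈ q.rest, ¬C.Adj none (some b)) (hn : Nat.card B = n + 1)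
    (hP : ForallExtension H (some q.snd) (List.IsChain C.Adj) n (some q.fst) [none]) :
    q.IsUniquePassage H C := by
  refine ⟨hle, hC, h, fun D hDH hD hqD => ?_⟩
  obtain ⟨l, path, chain⟩ := hq.of_forallExtension hDH hD hqD hn hP
  have core := hq.core hle hC h
  have coreD := hq.core hDH hD hqD
  exact hC.eq_of_isHamPathOff hD path (by simpa using hq.fst_ne_snd.symm)
    ((coreD.adj_none _).2 (.inl rfl)) ((coreD.adj_none _).2 (.inr (.inl rfl)))
    ((core.adj_none _).2 (.inl rfl)) ((core.adj_none _).2 (.inr (.inl rfl)))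
    (List.isChain_append.1 (by simpa using chain : ((some q.snd :: l) ++ [none]).IsChain _)).1

end IsAt

end Port

/-! ### The four gadgets -/

lemma deg_eq_card_filter {V : Type*} [Fintype V] (G : SimpleGraph V) [DecidableRel G.Adj] (v : V) :
    deg G v = (Finset.univ.filter (G.Adj v)).card := by
  rw [deg, ← Set.ncard_coe_finset]
  congr 1
  ext u
  simp

lemma isHamCycle_of_reachableIn {V : Type*} [Fintype V] {C : SimpleGraph V} [DecidableRel C.Adj]
    (n : ℕ) (r : V) (hreach : ∀ u, ReachableIn C n r u)
    (hdeg : ∀ v, (Finset.univ.filter (C.Adj v)).card = 2) : IsHamCycle C :=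
  ⟨SimpleGraph.connected_iff_exists_forall_reachable C |>.2 ⟨r, fun u => (hreach u).reachable⟩,
    fun v => (deg_eq_card_filter C v).trans (hdeg v)⟩

section Split

variable {B : Type*} {q : Port B} {H : SimpleGraph (Option B)}

instance Port.decidableSplitAdj [DecidableEq B] [DecidableRel H.Adj] [DecidablePred (· ∈ q.rest)] :
    DecidableRel (q.split H).Adj
  | some (some b), some (some b') => inferInstanceAs (Decidable (H.Adj (some b) (some b')))
  | none, some (some b) => inferInstanceAs (Decidable (b = q.fst ∨ b = q.snd))
  | some (some b), none => inferInstanceAs (Decidable (b = q.fst ∨ b = q.snd))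
  | some none, some (some b) => inferInstanceAs (Decidable (b ∈ q.rest))
  | some (some b), some none => inferInstanceAs (Decidable (b ∈ q.rest))
  | none, none => inferInstanceAs (Decidable False)
  | none, some none => inferInstanceAs (Decidable False)
  | some none, none => inferInstanceAs (Decidable False)
  | some none, some none => inferInstanceAs (Decidable False)

lemma Port.IsAt.split (hq : q.IsAt H) :
    (⟨some q.fst, some q.snd, ∅⟩ : Port (Option B)).IsAt (q.split H) where
  fst_ne_snd h := hq.fst_ne_snd (Option.some.inj h)
  fst_notMem := id
  snd_notMem := id
  adj_none b := by rcases b with _ | b <;> simp [Port.split]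

end Split

/-- The number by which a vertex is referred to in `ofRows`. -/
def code {k : ℕ} : Option (Fin k) → ℕ
  | none => 0
  | some i => i + 1

/-- The graph in which the vertex with code `i` is joined to the vertices whose codes are listed in
the `i`-th row. Each edge needs to be listed at one of its ends only. -/
def ofRows (k : ℕ) (rows : List (List ℕ)) : SimpleGraph (Option (Fin k)) :=
  .fromRel fun u v => code v ∈ rows.getD (code u) []

instance ofRows.decidableAdj (k : ℕ) (rows : List (List ℕ)) : DecidableRel (ofRows k rows).Adj :=
  fun u v => inferInstanceAs (Decidable (u ≠ v ∧
    (code v ∈ rows.getD (code u) [] ∨ code u ∈ rows.getD (code v) [])))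

/-- The complete graph on four vertices. Replacing a vertex by it minus `none` amounts to expanding
the vertex to a triangle. -/
def tetrahedron : SimpleGraph (Option (Fin 3)) := ofRows 3 [[1, 2, 3], [2, 3], [3]]

/-- The hamiltonian cycle of `tetrahedron` to be used in the gadget. -/
def tetrahedronCycle : SimpleGraph (Option (Fin 3)) := ofRows 3 [[2], [0], [3], [1]]

/-- The wheel with hub `some 0` and rim `none`, `some 1`, `some 2`, `some 3`. -/
def wheel : SimpleGraph (Option (Fin 4)) := ofRows 4 [[1, 2, 4], [2, 3, 4], [3], [4]]

/-- The hamiltonian cycle of `wheel` to be used in the gadget. -/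
def wheelCycle : SimpleGraph (Option (Fin 4)) := ofRows 4 [[2], [0], [3], [4], [1]]

/-- The Petersen graph with an edge subdivided, where the new vertex is then identified with a
vertex off that edge. -/
def petersen : SimpleGraph (Option (Fin 9)) :=
  ofRows 9 [[1, 2, 3, 4, 5], [4, 8], [5, 6], [6, 8], [7], [9], [7], [9], [9]]

/-- The hamiltonian cycle of `petersen` to be used in the gadget. -/
def petersenCycle : SimpleGraph (Option (Fin 9)) :=
  ofRows 9 [[2], [0], [5], [6], [1], [9], [7], [4], [3], [8]]

/-- A graph all of whose hamiltonian cycles use the edge from `none` to `some 0`. The vertex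
`some 0` has degree four, all others have degree three. -/
def seed : SimpleGraph (Option (Fin 12)) :=
  ofRows 12 [[1, 2, 3], [10, 11, 12], [6, 11], [5, 6], [5, 9, 12], [10], [7], [8, 12], [9, 10],
    [11]]

/-- The only hamiltonian cycle of `seed` that avoids the edge from `none` to `some 2`. -/
def seedCycle : SimpleGraph (Option (Fin 12)) :=
  ofRows 12 [[1], [11], [0], [6], [12], [3], [2], [8], [10], [4], [5], [9], [7]]

instance tetrahedron.decidableAdj : DecidableRel tetrahedron.Adj := ofRows.decidableAdj _ _
instance tetrahedronCycle.decidableAdj : DecidableRel tetrahedronCycle.Adj :=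
  ofRows.decidableAdj _ _
instance wheel.decidableAdj : DecidableRel wheel.Adj := ofRows.decidableAdj _ _
instance wheelCycle.decidableAdj : DecidableRel wheelCycle.Adj := ofRows.decidableAdj _ _
instance petersen.decidableAdj : DecidableRel petersen.Adj := ofRows.decidableAdj _ _
instance petersenCycle.decidableAdj : DecidableRel petersenCycle.Adj := ofRows.decidableAdj _ _
instance seed.decidableAdj : DecidableRel seed.Adj := ofRows.decidableAdj _ _
instance seedCycle.decidableAdj : DecidableRel seedCycle.Adj := ofRows.decidableAdj _ _

set_option synthInstance.maxSize 256

lemma isGadget_tetrahedron : IsGadget ⟨0, 1, {2}⟩ tetrahedron tetrahedronCycle :=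
  have isAt : Port.IsAt ⟨0, 1, {2}⟩ tetrahedron := by constructor <;> decide +kernel
  have isHamCycle : IsHamCycle tetrahedronCycle :=
    isHamCycle_of_reachableIn 2 none (by decide +kernel) (by decide +kernel)
  { threeConnected := threeConnected_of_reachableIn 2 (by decide +kernel)
    isAt := isAt
    rest_nonempty := ⟨2, rfl⟩
    not_isHamCycle_of_le_split := Port.not_isHamCycle_of_le_split rfl
    isUniquePassage := isAt.isUniquePassage_of_forallExtension (n := 2) (by decide +kernel)
      isHamCycle (by decide +kernel) (by simp) (by decide +kernel) }

lemma isGadget_wheel : IsGadget ⟨0, 1, {3}⟩ wheel wheelCycle :=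
  have isAt : Port.IsAt ⟨0, 1, {3}⟩ wheel := by constructor <;> decide +kernel
  have isHamCycle : IsHamCycle wheelCycle :=
    isHamCycle_of_reachableIn 2 none (by decide +kernel) (by decide +kernel)
  { threeConnected := threeConnected_of_reachableIn 2 (by decide +kernel)
    isAt := isAt
    rest_nonempty := ⟨3, rfl⟩
    not_isHamCycle_of_le_split := Port.not_isHamCycle_of_le_split rfl
    isUniquePassage := isAt.isUniquePassage_of_forallExtension (n := 3) (by decide +kernel)
      isHamCycle (by decide +kernel) (by simp) (by decide +kernel) }

lemma isGadget_petersen : IsGadget ⟨0, 1, {2, 3, 4}⟩ petersen petersenCycle :=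
  have isAt : Port.IsAt ⟨0, 1, {2, 3, 4}⟩ petersen := by constructor <;> decide +kernel
  have isHamCycle : IsHamCycle petersenCycle :=
    isHamCycle_of_reachableIn 5 none (by decide +kernel) (by decide +kernel)
  { threeConnected := threeConnected_of_reachableIn 3 (by decide +kernel)
    isAt := isAt
    rest_nonempty := ⟨2, by simp⟩
    not_isHamCycle_of_le_split := fun _ hle hD =>
      isAt.split.not_isAvoided_of_forallExtension (n := 9) (by simp) (by decide +kernel) hle hD
        fun _ h => h.elim
    isUniquePassage := isAt.isUniquePassage_of_forallExtension (n := 8) (by decide +kernel)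
      isHamCycle (by decide +kernel) (by simp) (by decide +kernel) }

lemma isGadget_seed : IsGadget ⟨1, 0, {2}⟩ seed seedCycle :=
  have isAt : Port.IsAt ⟨1, 0, {2}⟩ seed := by constructor <;> decide +kernel
  have isHamCycle : IsHamCycle seedCycle :=
    isHamCycle_of_reachableIn 6 none (by decide +kernel) (by decide +kernel)
  { threeConnected := threeConnected_of_reachableIn 5 (by decide +kernel)
    isAt := isAt
    rest_nonempty := ⟨2, rfl⟩
    not_isHamCycle_of_le_split := Port.not_isHamCycle_of_le_split rfl
    isUniquePassage := isAt.isUniquePassage_of_forallExtension (n := 11) (by decide +kernel)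
      isHamCycle (by decide +kernel) (by simp) (by decide +kernel) }

lemma IsHamCycle.adj_none_seed {D : SimpleGraph (Option (Fin 12))} (hD : IsHamCycle D)
    (hle : D ≤ seed) : D.Adj none (some 0) := by
  have isAt : Port.IsAt ⟨1, 2, {0}⟩ seed := by constructor <;> decide +kernel
  by_contra h
  refine isAt.not_isAvoided_of_forallExtension (n := 11) (by simp) (by decide +kernel) hle hD ?_
  rintro _ rfl
  exact h

/-! ### Growing graphs -/

section Transport

variable {V W : Type*} (e : W ≃ V) {G C : SimpleGraph V}

lemma deg_comap (G : SimpleGraph V) (w : W) : deg (G.comap e) w = deg G (e w) :=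
  (deg_iso (SimpleGraph.Iso.comap e G) w).symm

lemma IsHamCycle.comap (h : IsHamCycle C) : IsHamCycle (C.comap e) :=
  ⟨(SimpleGraph.Iso.comap e C).connected_iff.2 h.connected, fun w => by
    rw [deg_comap, h.deg_eq_two]⟩

lemma IsUniqueHamCycle.comap (h : IsUniqueHamCycle G C) :
    IsUniqueHamCycle (G.comap e) (C.comap e) where
  le _ _ huv := h.le huv
  isHamCycle := h.isHamCycle.comap e
  eq C' hle hC' := by
    rw [← h.eq (C'.comap e.symm) (fun u v huv => by simpa using hle huv) (hC'.comap e.symm)]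
    ext u v
    simp

lemma ThreeConnected.comap (h : ThreeConnected G) : ThreeConnected (G.comap e) := fun x y => by
  refine .of_iso (SimpleGraph.Iso.comap e G).symm ?_
  convert h (e x) (e y) using 1
  ext v
  simp [Equiv.symm_apply_eq]

end Transport

section Degrees

/-- The multiset of the degrees of all vertices. -/
noncomputable def degrees {V : Type*} [Fintype V] (G : SimpleGraph V) : Multiset ℕ :=
  Finset.univ.val.map (deg G)

lemma degrees_comap {V W : Type*} [Fintype V] [Fintype W] (e : W ≃ V) (G : SimpleGraph V) :
    degrees (G.comap e) = degrees G := by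
  rw [degrees, degrees, ← Finset.univ_map_equiv_to_embedding e, Finset.map_val, Multiset.map_map]
  exact Multiset.map_congr rfl fun w _ => deg_comap e G w

lemma degrees_option {A : Type*} [Fintype A] (G : SimpleGraph (Option A)) :
    degrees G = deg G none ::ₘ Finset.univ.val.map fun a => deg G (some a) := by
  simp [degrees, univ_option, Finset.insertNone]

lemma degrees_sum {A B : Type*} [Fintype A] [Fintype B] (G : SimpleGraph (A ⊕ B)) :
    degrees G = (Finset.univ.val.map fun a => deg G (.inl a)) +
      Finset.univ.val.map fun b => deg G (.inr b) := by
  simp [degrees, ← Finset.univ_disjSum_univ, Multiset.disjSum]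

lemma cons_map_eq_cons_map {α β : Type*} {S : Finset α} {w : α} {f g : α → β} (hw : w ∈ S)
    (h : ∀ a ∈ S, a ≠ w → f a = g a) : f w ::ₘ S.val.map g = g w ::ₘ S.val.map f := by
  classical
  rw [← Finset.insert_erase hw, Finset.insert_val_of_notMem (by simp), Multiset.map_cons,
    Multiset.map_cons, Multiset.cons_swap]
  congr 2
  exact Multiset.map_congr rfl fun a ha =>
    have ha := Finset.mem_erase.1 ha
    (h a ha.2 ha.1).symm

lemma map_val_eraseNone {A β : Type*} {S : Finset (Option A)} (hS : none ∉ S) (f : Option A → β) :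
    S.eraseNone.val.map (fun a => f (some a)) = S.val.map f := by
  classical
  conv_rhs => rw [← Finset.erase_eq_of_notMem hS, ← Finset.map_some_eraseNone, Finset.map_val,
    Multiset.map_map]
  rfl

end Degrees

/-- `G` is `3`-connected with `C` as its only hamiltonian cycle, and the degree of each vertex of
`S` can be raised by replacing a neighbour with a gadget. -/
structure IsGrowable {V : Type*} (G C : SimpleGraph V) (S : Finset V) : Prop where
  threeConnected : ThreeConnected G
  isUniqueHamCycle : IsUniqueHamCycle G C
  exists_adj : ∀ w ∈ S, ∃ v ∉ S, deg G v = 3 ∧ G.Adj v w ∧ ¬C.Adj v w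

/-- Some growable graph has the degrees `s`, where those of the vertices that can be grown are
`t`. -/
def ExistsGrowable (t s : Multiset ℕ) : Prop :=
  ∃ (V : Type) (_ : Fintype V) (G C : SimpleGraph V) (S : Finset V),
    IsGrowable G C S ∧ S.val.map (deg G) = t ∧ degrees G = s

lemma ExistsGrowable.forget {t s : Multiset ℕ} (h : ExistsGrowable t s) : ExistsGrowable 0 s := by
  obtain ⟨V, _, G, C, S, ⟨hG, hC, -⟩, -, hs⟩ := h
  exact ⟨V, _, G, C, ∅, ⟨hG, hC, by simp⟩, rfl, hs⟩

lemma IsGrowable.comap {V W : Type*} {G C : SimpleGraph V} {S : Finset V} (h : IsGrowable G C S)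
    (e : W ≃ V) : IsGrowable (G.comap e) (C.comap e) (S.map e.symm.toEmbedding) where
  threeConnected := h.threeConnected.comap e
  isUniqueHamCycle := h.isUniqueHamCycle.comap e
  exists_adj := by
    simp only [Finset.forall_mem_map]
    intro w hw
    obtain ⟨v, hvS, hv, hG, hC⟩ := h.exists_adj w hw
    exact ⟨e.symm v, by simpa using hvS, by simpa [deg_comap] using hv, by simpa using hG,
      by simpa using hC⟩

lemma deg_petersen (b : Fin 9) : deg petersen (some b) = 3 := by
  rw [deg_eq_card_filter]
  revert b
  decide +kernel

lemma IsGrowable.splice_petersen {A : Type*} [Finite A] {p : Port A} {G C : SimpleGraph (Option A)}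
    {S : Finset (Option A)} {w : A} (h : IsGrowable G C S) (hw : p.rest = {w})
    (hwS : some w ∈ S) (hp : p.IsAt G) (hpC : p.IsAvoided C) :
    IsGrowable (glue G petersen (p.Cross ⟨0, 1, {2, 3, 4}⟩))
      (glue C petersenCycle (p.core.Cross ⟨0, 1, ∅⟩)) (S.eraseNone.map .inl) where
  threeConnected := isGadget_petersen.threeConnected_splice h.threeConnected hw hp
  isUniqueHamCycle := isGadget_petersen.isUniqueHamCycle_splice h.isUniqueHamCycle hw hp hpC
  exists_adj := by
    have core := hp.core h.isUniqueHamCycle.le h.isUniqueHamCycle.isHamCycle hpC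
    simp only [Finset.forall_mem_map, Finset.mem_eraseNone, Function.Embedding.inl_apply]
    intro a ha
    obtain rfl | haw := eq_or_ne a w
    · refine ⟨.inr 2, by simp, (isGadget_petersen.isAt.deg_splice_inr hw 2).trans
        (deg_petersen 2), ?_, ?_⟩
      · simp [Port.Cross, hw]
      · simp [Port.Cross]
    obtain ⟨_ | v, hvS, hv, hG, hC⟩ := h.exists_adj (some a) ha
    · -- The only edge at `none` off `C` leads to `w`, which lies in `S`.
      have := (hp.adj_none a).1 hG
      have : a ≠ p.fst ∧ a ≠ p.snd := by simpa [core.adj_none, Port.core] using hC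
      grind
    · have hvw : v ∉ p.rest := by
        rw [hw]
        rintro rfl
        exact hvS hwS
      exact ⟨.inl v, by simpa using hvS, (hp.deg_splice_inl hvw).trans hv, hG, hC⟩

lemma IsGrowable.existsGrowable_petersen {A : Type} [Fintype A] {G C : SimpleGraph (Option A)}
    {S : Finset (Option A)} {w : A} (h : IsGrowable G C S) (hS : none ∉ S) (hwS : some w ∈ S)
    (hd : deg G none = 3) (hG : G.Adj none (some w)) (hC : ¬C.Adj none (some w))
    {t s : Multiset ℕ} (ht : S.val.map (deg G) = deg G (some w) ::ₘ t)
    (hs : degrees G = deg G (some w) ::ₘ s) :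
    ExistsGrowable ((deg G (some w) + 2) ::ₘ t)
      ((deg G (some w) + 2) ::ₘ (s + Multiset.replicate 8 3)) := by
  obtain ⟨p, w, ⟨rfl⟩, hw, hp, hpC⟩ :=
    h.isUniqueHamCycle.isHamCycle.exists_port h.isUniqueHamCycle.le hd hG hC
  set G' := glue G petersen (p.Cross ⟨0, 1, {2, 3, 4}⟩)
  have deg_w : deg G' (.inl w) = deg G (some w) + 2 := by
    have : deg G' (.inl w) + 1 = deg G (some w) + ({2, 3, 4} : Set (Fin 9)).ncard :=
      deg_splice_hub hw hp
    rw [show ({2, 3, 4} : Set (Fin 9)) = ({2, 3, 4} : Finset (Fin 9)) by simp,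
      Set.ncard_coe_finset] at this
    exact Nat.succ_injective this
  have deg_left : ∀ a ≠ w, deg G' (.inl a) = deg G (some a) := fun a ha =>
    hp.deg_splice_inl (by simpa [hw] using ha)
  have deg_right : ∀ b, deg G' (.inr b) = 3 := fun b =>
    (isGadget_petersen.isAt.deg_splice_inr hw b).trans (deg_petersen b)
  have swap : ∀ T : Finset A, w ∈ T →
      (deg G (some w) + 2) ::ₘ T.val.map (fun a => deg G (some a)) =
        deg G (some w) ::ₘ T.val.map fun a => deg G' (.inl a) := fun T hT =>
    deg_w ▸ cons_map_eq_cons_map hT fun a _ => deg_left a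
  refine ⟨_, inferInstance, G', _, _, h.splice_petersen hw hwS hp hpC, ?_, ?_⟩
  · have swap := swap S.eraseNone (by simpa using hwS)
    rw [map_val_eraseNone hS, ht, Multiset.cons_swap, Multiset.cons_inj_right] at swap
    rw [swap, Finset.map_val, Multiset.map_map]
    rfl
  · have swap := swap Finset.univ (Finset.mem_univ w)
    rw [degrees_option, hd] at hs
    have right_side : (Finset.univ.val.map fun b => deg G' (.inr b)) = 3 ::ₘ .replicate 8 3 := by
      simp [deg_right, ← Multiset.replicate_succ]
    rw [degrees_sum, right_side, ← Multiset.cons_inj_right (deg G (some w)), ← Multiset.cons_add,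
      ← swap, Multiset.cons_swap, ← Multiset.cons_add _ s, ← hs]
    simp only [← Multiset.singleton_add]
    abel


lemma ExistsGrowable.grow {d : ℕ} {t s : Multiset ℕ} (h : ExistsGrowable (d ::ₘ t) (d ::ₘ s)) :
    ExistsGrowable ((d + 2) ::ₘ t) ((d + 2) ::ₘ (s + .replicate 8 3)) := by
  classical
  obtain ⟨V, _, G, C, S, h, ht, hs⟩ := h
  obtain ⟨w, hwS, rfl⟩ : ∃ w ∈ S, deg G w = d :=
    Multiset.mem_map.1 (ht ▸ Multiset.mem_cons_self d t)
  obtain ⟨v, hvS, hv, hG, hC⟩ := h.exists_adj w hwS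
  obtain ⟨w, rfl⟩ := (Equiv.optionSubtypeNe v).surjective w
  set e := Equiv.optionSubtypeNe v
  rcases w with _ | w
  · exact absurd hG G.irrefl
  have deg_w : deg (G.comap e) (some w) = deg G (e (some w)) := deg_comap e G _
  rw [← deg_w] at ht hs ⊢
  refine (h.comap e).existsGrowable_petersen ?_ ?_ ((deg_comap e G none).trans hv)
    (w := w) hG hC ?_ ((degrees_comap e G).trans hs)
  · simpa [e, Equiv.symm_apply_eq] using hvS
  · simpa using hwS
  · rw [← ht, Finset.map_val, Multiset.map_map]
    exact Multiset.map_congr rfl fun a _ => by simp [deg_comap]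

lemma ExistsGrowable.grow_iterate {d : ℕ} {t s : Multiset ℕ}
    (h : ExistsGrowable (d ::ₘ t) (d ::ₘ s)) (j : ℕ) :
    ExistsGrowable ((d + 2 * j) ::ₘ t) ((d + 2 * j) ::ₘ (s + .replicate (8 * j) 3)) := by
  induction j with
  | zero => simpa using h
  | succ j ih => simpa only [add_assoc, mul_add, mul_one, Multiset.replicate_add] using ih.grow

lemma IsHamCycle.exists_adj_not_adj {V : Type*} [Finite V] {G C : SimpleGraph V}
    (hC : IsHamCycle C) {v : V} (hv : 2 < deg G v) : ∃ w, G.Adj v w ∧ ¬C.Adj v w :=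
  Set.exists_mem_notMem_of_ncard_lt_ncard ((hC.deg_eq_two v).trans_lt hv)

lemma ExistsGrowable.splice_gadget {B : Type} [Fintype B] {q : Port B}
    {H D : SimpleGraph (Option B)} {c b v : B} {t s u : Multiset ℕ}
    (h : ExistsGrowable t s) (hs : 3 ∈ s) (hg : IsGadget q H D)
    (hq : q.rest = {c}) (hv : deg H (some v) = 3) (hH : H.Adj (some v) (some b))
    (hD : ¬D.Adj (some v) (some b))
    (hu : (Finset.univ.val.map fun b => deg H (some b)) = 3 ::ₘ u) :
    ExistsGrowable {deg H (some b)} (s + u) := by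
  classical
  obtain ⟨V, _, G', C', S, h, -, rfl⟩ := h
  obtain ⟨z, -, hz⟩ := Multiset.mem_map.1 hs
  let e := Equiv.optionSubtypeNe z
  have hC := h.isUniqueHamCycle.comap e
  have hd : deg (G'.comap e) none = 3 := (deg_comap e G' none).trans hz
  obtain ⟨x, hGx, hCx⟩ := hC.isHamCycle.exists_adj_not_adj hd.ge
  obtain ⟨p, w, rfl, hw, hp, hpC⟩ := hC.isHamCycle.exists_port hC.le hd hGx hCx
  have deg_right : ∀ b, deg (glue (G'.comap e) H (p.Cross q)) (.inr b) = deg H (some b) :=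
    hg.isAt.deg_splice_inr hw
  refine ⟨_, inferInstance, _, _, {.inr b}, ⟨hg.threeConnected_splice (h.threeConnected.comap e)
    hw hp, hg.isUniqueHamCycle_splice hC hw hp hpC, ?_⟩, ?_, ?_⟩
  · simp only [Finset.mem_singleton, forall_eq]
    have ne : v ≠ b := fun hvb => H.irrefl (hvb ▸ hH)
    exact ⟨.inr v, by simpa using ne, (deg_right v).trans hv, hH, hD⟩
  · simp [deg_right]
  · rw [← degrees_comap e, degrees_sum, degrees_option, hd]
    simp only [deg_right, hu, deg_splice_inl_of_rest_eq_singleton hp hq]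
    rw [Multiset.cons_add, Multiset.add_cons]

lemma existsGrowable_seed_glue_seed :
    ExistsGrowable {4, 4} (4 ::ₘ 4 ::ₘ .replicate 22 3) := by
  let p : Port (Fin 12) := ⟨0, 1, {2}⟩
  let q : Port (Fin 12) := ⟨1, 0, {2}⟩
  have hq : q.IsAt seed := isGadget_seed.isAt
  have hp : p.IsAt seed := by constructor <;> decide +kernel
  have hCq : q.IsUniquePassage seed seedCycle := isGadget_seed.isUniquePassage
  have hCp : p.IsUniquePassage seed seedCycle := ⟨hCq.le, hCq.isHamCycle, hCq.isAvoided, hCq.eq⟩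
  have deg_left : ∀ a, deg (glue seed seed (p.Cross q)) (.inl a) = deg seed (some a) :=
    deg_splice_inl_of_rest_eq_singleton hp rfl
  have deg_right : ∀ b, deg (glue seed seed (p.Cross q)) (.inr b) = deg seed (some b) :=
    hq.deg_splice_inr rfl
  have deg_seed : (fun b => deg seed (some b)) = fun b => if b = 0 then 4 else 3 := by
    funext b
    rw [deg_eq_card_filter]
    revert b
    decide +kernel
  have unique : IsUniqueHamCycle (glue seed seed (p.Cross q)) _ :=
    isUniqueHamCycle_splice rfl hp hq isGadget_seed.not_isHamCycle_of_le_split hCp hCq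
      fun D₁ hD₁ D₂ hD₂ ham₁ ham₂ => ⟨.inl (ham₁.adj_none_seed hD₁), .inr (ham₂.adj_none_seed hD₂)⟩
  refine ⟨_, inferInstance, _, _, {.inl 0, .inr 0}, ⟨?_, unique, ?_⟩, ?_, ?_⟩
  · exact threeConnected_splice isGadget_seed.threeConnected isGadget_seed.threeConnected hp hq
      ⟨2, rfl⟩ ⟨2, rfl⟩
  · have adj : seed.Adj (some 9) (some 0) := by decide
    have not_adj : ¬seedCycle.Adj (some 9) (some 0) := by decide
    simp only [Finset.mem_insert, Finset.mem_singleton, forall_eq_or_imp, forall_eq]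
    exact ⟨⟨.inl 9, by simp, (deg_left 9).trans (congr_fun deg_seed 9), adj, not_adj⟩,
      ⟨.inr 9, by simp, (deg_right 9).trans (congr_fun deg_seed 9), adj, not_adj⟩⟩
  · simp [deg_left, deg_right, congr_fun deg_seed 0]
  · simp only [degrees_sum, deg_left, deg_right, deg_seed]
    decide +kernel

section AddDegrees

/-- Any graph as in the construction that has a vertex of degree three can be enlarged so that its
multiset of degrees grows by `t`. -/
def CanAddDegrees (t : Multiset ℕ) : Prop :=
  ∀ s, 3 ∈ s → ExistsGrowable 0 s → ExistsGrowable 0 (s + t)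

lemma CanAddDegrees.add {t u : Multiset ℕ} (ht : CanAddDegrees t) (hu : CanAddDegrees u) :
    CanAddDegrees (t + u) := fun s h3 hs => by
  rw [← add_assoc]
  exact hu _ (Multiset.mem_add.2 (.inl h3)) (ht s h3 hs)

lemma CanAddDegrees.nsmul {t : Multiset ℕ} (ht : CanAddDegrees t) (i : ℕ) :
    CanAddDegrees (i • t) := by
  induction i with
  | zero => exact fun s _ hs => by simpa using hs
  | succ i ih => exact succ_nsmul t i ▸ ih.add ht

lemma canAddDegrees_of_existsGrowable {d m : ℕ}
    (splice : ∀ s, 3 ∈ s → ExistsGrowable 0 s → ExistsGrowable {d} (s + d ::ₘ .replicate m 3))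
    (j : ℕ) :
    CanAddDegrees ((d + 2 * j) ::ₘ .replicate (m + 8 * j) 3) := fun s h3 hs => by
  have h := splice s h3 hs
  rw [Multiset.add_cons] at h
  simpa only [Multiset.add_cons, add_assoc, Multiset.replicate_add] using (h.grow_iterate j).forget

lemma exists_canAddDegrees_cons {d : ℕ} (hd : 3 ≤ d) :
    ∃ e, CanAddDegrees (d ::ₘ .replicate e 3) := by
  rcases Nat.even_or_odd' d with ⟨c, rfl | rfl⟩
  · obtain ⟨j, rfl⟩ : ∃ j, c = 2 + j := Nat.exists_eq_add_of_le (by omega)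
    have deg_hub : deg wheel (some 0) = 4 := by rw [deg_eq_card_filter]; decide +kernel
    have deg_rim : deg wheel (some 1) = 3 := by rw [deg_eq_card_filter]; decide +kernel
    refine ⟨_, mul_add 2 2 j ▸
      canAddDegrees_of_existsGrowable (d := 4) (m := 2) (fun s h3 hs => ?_) j⟩
    exact deg_hub ▸ hs.splice_gadget h3 isGadget_wheel rfl deg_rim (by decide) (by decide)
      (by simp only [deg_eq_card_filter]; decide +kernel)
  · obtain ⟨j, rfl⟩ : ∃ j, c = 1 + j := Nat.exists_eq_add_of_le (by omega)
    have deg_hub : deg tetrahedron (some 0) = 3 := by rw [deg_eq_card_filter]; decide +kernel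
    have deg_rim : deg tetrahedron (some 1) = 3 := by rw [deg_eq_card_filter]; decide +kernel
    refine ⟨_, (by ring : 3 + 2 * j = 2 * (1 + j) + 1) ▸
      canAddDegrees_of_existsGrowable (d := 3) (m := 1) (fun s h3 hs => ?_) j⟩
    exact deg_hub ▸ hs.splice_gadget h3 isGadget_tetrahedron rfl deg_rim (by decide) (by decide)
      (by simp only [deg_eq_card_filter]; decide +kernel)

lemma exists_canAddDegrees (t : Multiset ℕ) (ht : ∀ d ∈ t, 3 ≤ d) :
    ∃ e, CanAddDegrees (t + .replicate e 3) := by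
  induction t using Multiset.induction_on with
  | empty => exact ⟨0, fun s _ hs => by simpa using hs⟩
  | cons d t ih =>
    obtain ⟨e, he⟩ := ih fun d hd => ht d (Multiset.mem_cons_of_mem hd)
    obtain ⟨e', he'⟩ := exists_canAddDegrees_cons (ht d (Multiset.mem_cons_self d t))
    refine ⟨e' + e, ?_⟩
    convert he'.add he using 1
    rw [Multiset.replicate_add, Multiset.cons_add, Multiset.cons_add, add_left_comm]

lemma exists_existsGrowable_of_even {d : ℕ} (hd : Even d) (h4 : 4 ≤ d) :
    ∃ s, ExistsGrowable 0 s ∧ ∀ k, k ∈ s ↔ k = 3 ∨ k = d := by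
  obtain ⟨j, rfl⟩ : ∃ j, d = 4 + 2 * j := by
    obtain ⟨c, rfl⟩ := hd
    exact ⟨c - 2, by omega⟩
  have grown := existsGrowable_seed_glue_seed.grow_iterate j
  rw [Multiset.cons_add, Multiset.cons_swap,
    show (4 + 2 * j) ::ₘ {4} = 4 ::ₘ {4 + 2 * j} from Multiset.pair_comm _ _] at grown
  refine ⟨_, (grown.grow_iterate j).forget, fun k => ?_⟩
  simp only [Multiset.cons_add, Multiset.mem_cons, Multiset.mem_add, Multiset.mem_replicate]
  tauto

lemma exists_existsGrowable {M : Finset ℕ} (hM : IsLeast (M : Set ℕ) 3) (hE : ∃ d ∈ M, Even d) :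
    ∃ s, ExistsGrowable 0 s ∧ ∀ k, k ∈ s ↔ k ∈ M := by
  obtain ⟨d, hdM, hd⟩ := hE
  have h4 : 4 ≤ d := (hM.2 hdM).lt_of_ne (by rintro rfl; exact absurd hd (by decide))
  obtain ⟨s, hs, mem_s⟩ := exists_existsGrowable_of_even hd h4
  obtain ⟨e, he⟩ := exists_canAddDegrees M.val fun k hk => hM.2 hk
  refine ⟨_, he s ((mem_s 3).2 (.inl rfl)) hs, fun k => ?_⟩
  have three_mem : 3 ∈ M := hM.1
  simp only [Multiset.mem_add, mem_s, Finset.mem_val, Multiset.mem_replicate]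
  grind

end AddDegrees

/-! ### Realizations -/

section Realize

lemma numDegree_eq_count {V : Type} [Fintype V] (G : SimpleGraph V) (k : ℕ) :
    numDegree G k = (degrees G).count k := by
  rw [numDegree, degrees, Multiset.count_map, Finset.card_def, Finset.filter_val]
  congr 2
  ext v
  rw [degree_eq_deg, eq_comm]

lemma mem_degreeSet_iff {V : Type} [Fintype V] (G : SimpleGraph V) (k : ℕ) :
    k ∈ degreeSet G ↔ k ∈ degrees G := by
  simp [degreeSet, degrees, degree_eq_deg]

theorem Realizes.exists_even {V : Type} [Fintype V] {G : SimpleGraph V} {M : Finset ℕ}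
    (h : Realizes G M) : ∃ d ∈ M, Even d := by
  obtain ⟨C, hC⟩ := (isUniquelyHamiltonian_iff G).1 h.2.1
  obtain ⟨v, hv⟩ := hC.exists_even_deg
  refine ⟨_, ?_, hv⟩
  rw [← Finset.mem_coe, ← h.2.2, mem_degreeSet_iff]
  exact Multiset.mem_map_of_mem _ (Finset.mem_univ v)

lemma ExistsGrowable.exists_realizes {t s : Multiset ℕ} (h : ExistsGrowable t s) {M : Finset ℕ}
    (hM : IsLeast (M : Set ℕ) 3) (hs : ∀ k, k ∈ s ↔ k ∈ M) :
    ∃ (V : Type) (_ : Fintype V) (G : SimpleGraph V), Realizes G M ∧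
      Fintype.card V = s.card ∧ ∀ k, numDegree G k = s.count k := by
  classical
  obtain ⟨V, _, G, C, S, ⟨hG, hC, -⟩, -, rfl⟩ := h
  obtain ⟨v, -, hv⟩ := Multiset.mem_map.1 ((hs 3).2 hM.1)
  have card_gt : 3 < Fintype.card V := by
    rw [← hv, ← degree_eq_deg]
    exact G.degree_lt_card_verts v
  refine ⟨V, _, G, ⟨?_, (isUniquelyHamiltonian_iff G).2 ⟨C, hC⟩, ?_⟩, by simp [degrees],
    numDegree_eq_count G⟩
  · have two_notMem : 2 ∉ M := fun h2 => absurd (hM.2 h2) (by decide)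
    rw [if_neg two_notMem]
    exact (isKConnected_three_iff G).2 ⟨card_gt, hG⟩
  · ext k
    rw [mem_degreeSet_iff, hs, Finset.mem_coe]

lemma exists_realizes_sequence {M D : Finset ℕ} (hM : IsLeast (M : Set ℕ) 3)
    (hE : ∃ d ∈ M, Even d) (hD : D ⊆ M) :
    ∃ s t : Multiset ℕ, (∀ k, k ∈ s ↔ k ∈ M) ∧ (∀ k, k ∈ t ↔ k = 3 ∨ k ∈ D) ∧
      ∀ i : ℕ, ∃ (V : Type) (_ : Fintype V) (G : SimpleGraph V), Realizes G M ∧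
        Fintype.card V = (s + i • t).card ∧ ∀ k, numDegree G k = (s + i • t).count k := by
  obtain ⟨s, hs, mem_s⟩ := exists_existsGrowable hM hE
  obtain ⟨e, he⟩ := exists_canAddDegrees (3 ::ₘ D.val) (by
    simpa using fun k hk => hM.2 (hD hk))
  refine ⟨s, _, mem_s, fun k => ?_, fun i =>
    ((he.nsmul i) s ((mem_s 3).2 hM.1) hs).exists_realizes hM fun k => ?_⟩
  · simp only [Multiset.cons_add, Multiset.mem_cons, Multiset.mem_add, Finset.mem_val,
      Multiset.mem_replicate]
    tauto
  · have three_mem : 3 ∈ M := hM.1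
    simp only [Multiset.cons_add, Multiset.mem_add, mem_s, Multiset.mem_nsmul, Multiset.mem_cons,
      Finset.mem_val, Multiset.mem_replicate]
    grind

theorem stronglyUhcRealizable_of_exists_even {M : Finset ℕ} (hM : IsLeast (M : Set ℕ) 3)
    (hE : ∃ d ∈ M, Even d) : StronglyUhcRealizable M := by
  have nonempty : M.Nonempty := ⟨3, hM.1⟩
  have min_eq : M.min' nonempty = 3 := (M.isLeast_min' nonempty).unique hM
  refine ⟨nonempty, ?_, fun D₁ D₂ hdisj hunion => ?_⟩
  · obtain ⟨d, hdM, hd⟩ := hE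
    exact Finset.one_lt_card.2 ⟨3, hM.1, d, hdM, by rintro rfl; exact absurd hd (by decide)⟩
  rw [min_eq] at hunion
  have hD₂ : D₂ ⊆ M := (Finset.subset_union_right.trans_eq hunion).trans (Finset.erase_subset _ _)
  obtain ⟨s, t, mem_s, mem_t, hreal⟩ := exists_realizes_sequence hM hE hD₂
  have card_pos : 0 < t.card := Multiset.card_pos_iff_exists_mem.2 ⟨3, (mem_t 3).2 (.inl rfl)⟩
  choose V hV G hG hcard hnum using hreal
  refine ⟨s.card, 1 / (s.card + t.card), by positivity, V, hV, G, fun i j hij => ?_,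
    fun i => ⟨hG i, fun k hk => ?_, fun k hk => ?_⟩⟩
  · simpa [hcard] using Nat.mul_lt_mul_of_pos_right hij card_pos
  · have notMem_t : k ∉ t := by
      have hk₁ : k ∈ M.erase 3 := hunion ▸ Finset.mem_union_left D₂ hk
      rw [mem_t]
      rintro (rfl | hk₂)
      exacts [Finset.notMem_erase _ _ hk₁, Finset.disjoint_left.1 hdisj hk hk₂]
    simpa [hnum, Multiset.count_eq_zero_of_notMem notMem_t] using Multiset.count_le_card k s
  · have count_ge : 1 + i ≤ numDegree (G i) k := by
      have count_s : 1 ≤ s.count k := Multiset.one_le_count_iff_mem.2 ((mem_s k).2 (hD₂ hk))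
      have count_t : 1 ≤ t.count k := Multiset.one_le_count_iff_mem.2 ((mem_t k).2 (.inr hk))
      simpa [hnum] using add_le_add count_s (Nat.mul_le_mul_left i count_t)
    calc 1 / (s.card + t.card : ℝ) * (Fintype.card (V i) : ℝ)
        ≤ 1 + i := by
          rw [one_div, inv_mul_le_iff₀ (by positivity), hcard, Multiset.card_add,
            Multiset.card_nsmul]
          push_cast
          nlinarith [mul_nonneg (Nat.cast_nonneg (α := ℝ) s.card) (Nat.cast_nonneg (α := ℝ) i),
            Nat.cast_nonneg (α := ℝ) t.card]
      _ ≤ numDegree (G i) k := by exact_mod_cast count_ge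

theorem StronglyUhcRealizable.uhcRealizable {M : Finset ℕ} (h : StronglyUhcRealizable M) :
    UhcRealizable M := by
  obtain ⟨hM, -, h⟩ := h
  obtain ⟨_, _, -, V, hV, G, -, hG⟩ := h (M.erase (M.min' hM)) ∅ (by simp) (by simp)
  exact ⟨V 0, hV 0, G 0, (hG 0).1⟩

end Realize

end UHC

theorem theorem3p3 (M : Finset ℕ) (hM : IsLeast (M : Set ℕ) 3) :
    (UHC.UhcRealizable M ↔ ∃ d ∈ M, Even d) ∧
      ((∃ d ∈ M, Even d) → UHC.StronglyUhcRealizable M) := by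
  have strong := UHC.stronglyUhcRealizable_of_exists_even hM
  refine ⟨⟨?_, fun hE => (strong hE).uhcRealizable⟩, strong⟩
  rintro ⟨V, hV, G, hG⟩
  exact hG.exists_even
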